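/- Let $\mathfrak h$ and $\mathcal K$ be complex separable Hilbert spaces, let $\mathcal H=L^2(\mathbb R;\mathfrak h)$, and let $\mathcal M$ be the self-adjoint operator $(\mathcal M f)(x)=xf(x)$ in $\mathcal H$ with domain $\operatorname{Dom}\mathcal M=\{f\in\mathcal H:\int_{\mathbb R}\|f(x)\|^2(x^2+1)\,dx<\infty\}$. Let $G$ be an $\mathcal M$-bounded linear operator from $\mathcal H$ to $\mathcal K$, i.e. $\operatorname{Dom}\mathcal M\subset\operatorname{Dom}G$ and $G(\mathcal M-z)^{-1}$ is bounded for all $z\in\mathbb C$ with $\operatorname{Im}z\neq0$. For $\varphi\in L^2(\mathbb R)$ let $\varphi(\mathcal M)$ be multiplication by $\varphi$. The operator $G\varphi(\mathcal M)$ is defined on the dense set of bounded compactly supported $u\in L^2(\mathbb R;\mathfrak h)$ by $u\mapsto G(\varphi u)$, and is extended to $\mathcal H$ by continuity when it is bounded. For a compact operator $A$ with singular values $s_n(A)$ and $0<p<\infty$ put $\|A\|_p=(\sum_n s_n(A)^p)^{1/p}$, and let $\mathbf S_p(\mathfrak h,\mathcal K)$ be the Schatten class of the compact $A:\mathfrak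 h\to\mathcal K$ with $\|A\|_p<\infty$. We write $G\in\mathrm{Smooth}_p(\mathcal M)$ if there is $C$ such that for all $\varphi\in L^2(\mathbb R)$ the operator $G\varphi(\mathcal M)$ is bounded with $\|G\varphi(\mathcal M)\|\le C\|\varphi\|_{L^2}$ and $\|G\varphi(\mathcal M)\|_p\le C\|\varphi\|_{L^2}$; in this case $\|G\|_{\mathrm{Smooth}_p(\mathcal M)}=\sup_{\|\varphi\|_{L^2}=1}\|G\varphi(\mathcal M)\|_p$. Further, $L^\infty(\mathbb R;\mathbf S_p(\mathfrak h,\mathcal K))$ is the set of measurable $g$ with $\|g\|_{L^\infty(\mathbf S_p)}=\operatorname{ess\,sup}_x\|g(x)\|_p<\infty$, and $g$ is said to represent $G$ if $$Gf=\int_{\mathbb R}g(x)f(x)\,dx\qquad\text{for all }f\in\operatorname{Dom}\mathcal M.\tag{$*$}$$ (i) Let $2\le p<\infty$. Then $G\in\mathrm{Smooth}_p(\mathcal M)$ if and only if $(*)$ holds with some $g\in L^\infty(\mathbb R;\mathbf S_p(\mathfrak h,\mathcal K))$. Moreover, in this case $\|g\|_{L^\infty(\mathbf S_p)}=\|G\|_{\mathrm{Smooth}_p(\mathcal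 M)}$. (ii) Let $0<p<2$. If $G\in\mathrm{Smooth}_p(\mathcal M)$, then $(*)$ holds with some $g\in L^\infty(\mathbb R;\mathbf S_p(\mathfrak h,\mathcal K))$ such that $\|g\|_{L^\infty(\mathbf S_p)}\le\|G\|_{\mathrm{Smooth}_p(\mathcal M)}$. (iii) The converse of (ii) fails: for $\mathfrak h=\mathcal K=\ell^2$ there are an $\mathcal M$-bounded operator $G$ and a function $g$ representing $G$ such that $g\in L^\infty(\mathbb R;\mathbf S_p(\ell^2,\ell^2))$ with $\|g\|_{L^\infty(\mathbf S_p)}=1$ for every $0<p<\infty$, but $G\notin\mathrm{Smooth}_p(\mathcal M)$ for every $0<p<2$. -/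

import Mathlib

open MeasureTheory
open scoped ENNReal NNReal

noncomputable section

namespace KatoSmooth

/-- The (complex) Hilbert space `L²(ℝ; h)`. -/
abbrev L2 (h : Type*) [NormedAddCommGroup h] : Type _ := Lp h 2 (volume : Measure ℝ)

section Schatten

variable {E F : Type*} [NormedAddCommGroup E] [InnerProductSpace ℂ E] [CompleteSpace E]
  [NormedAddCommGroup F] [InnerProductSpace ℂ F] [CompleteSpace F]

/-- The multiplicity of the number `s` as a singular value of `A`, i.e. the multiplicity of `s²` as
an eigenvalue of `A* A`. For compact `A` and `s > 0` it is finite. -/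
def singularMult (A : E →L[ℂ] F) (s : ℝ≥0) : ℕ :=
  Module.finrank ℂ
    (Module.End.eigenspace ((A.adjoint ∘L A : E →L[ℂ] E) : E →ₗ[ℂ] E) (((s : ℝ) : ℂ) ^ 2))

open Classical in
/-- The Schatten (quasi-)norm `‖A‖_p = (∑ₙ sₙ(A)^p)^(1/p)`, `0 < p < ∞`, with values in `[0, ∞]`:
the sum runs over the singular values of the compact operator `A`, each taken with its multiplicity
(the value `s = 0` contributes nothing). It is `∞` if `A` is not compact. -/
def schattenNorm (p : ℝ) (A : E →L[ℂ] F) : ℝ≥0∞ :=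
  if IsCompactOperator A then
    (∑' s : ℝ≥0, (singularMult A s : ℝ≥0∞) * (s : ℝ≥0∞) ^ p) ^ (1 / p)
  else ⊤

/-- The norm of `L^∞(ℝ; S_p(E, F))`. -/
def linftySchattenNorm (p : ℝ) (g : ℝ → E →L[ℂ] F) : ℝ≥0∞ :=
  essSup (fun x => schattenNorm p (g x)) (volume : Measure ℝ)

/-- `g ∈ L^∞(ℝ; S_p(E, F))`. For separable `E`, `F` and functions with values in `S_p`, measurability
with respect to the operator norm is the same as measurability with respect to `‖·‖_p` and as weak
measurability. Finiteness of the essential supremum includes `g x ∈ S_p` for almost every `x`. -/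
def MemLinftySchatten (p : ℝ) (g : ℝ → E →L[ℂ] F) : Prop :=
  AEStronglyMeasurable g (volume : Measure ℝ) ∧ linftySchattenNorm p g < ⊤

end Schatten

section RelativelyBounded

variable {E F : Type*} [NormedAddCommGroup E] [InnerProductSpace ℂ E]
  [NormedAddCommGroup F] [InnerProductSpace ℂ F]

/-- `G` is `A`-bounded (for a self-adjoint operator `A`): `Dom A ⊆ Dom G` and `G (A - z)⁻¹` is
bounded for every `z` with `Im z ≠ 0`. As `A - z` maps `Dom A` onto the whole space, the latter says
`‖G u‖ ≤ C ‖(A - z) u‖` for all `u ∈ Dom A`. -/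
def RelBounded (A : E →ₗ.[ℂ] E) (G : E →ₗ.[ℂ] F) : Prop :=
  A.domain ≤ G.domain ∧
    ∀ z : ℂ, z.im ≠ 0 → ∃ C : ℝ, ∀ (u : E) (hA : u ∈ A.domain) (hG : u ∈ G.domain),
      ‖G ⟨u, hG⟩‖ ≤ C * ‖A ⟨u, hA⟩ - z • u‖

end RelativelyBounded

variable {h K : Type*} [NormedAddCommGroup h] [InnerProductSpace ℂ h]
  [NormedAddCommGroup K] [InnerProductSpace ℂ K]

/-- The operator of multiplication by `φ` in `L²(ℝ; h)` on its maximal domain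
`{f ∈ L² : φ f ∈ L²}`. -/
def mulOp (h : Type*) [NormedAddCommGroup h] [InnerProductSpace ℂ h] (φ : ℝ → ℂ) :
    L2 h →ₗ.[ℂ] L2 h where
  domain :=
    { carrier := {f | MemLp (fun x => φ x • f x) 2 (volume : Measure ℝ)}
      add_mem' := by
        intro a b ha hb
        refine (MemLp.add ha hb).ae_eq ?_
        filter_upwards [Lp.coeFn_add a b] with x hx
        rw [hx, Pi.add_apply, Pi.add_apply, smul_add]
      zero_mem' := by
        refine (MemLp.zero (ε := h) (p := 2) (μ := (volume : Measure ℝ))).ae_eq ?_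
        filter_upwards [Lp.coeFn_zero h 2 (volume : Measure ℝ)] with x hx
        rw [hx, Pi.zero_apply, smul_zero]
      smul_mem' := by
        intro c a ha
        refine (MemLp.const_smul ha c).ae_eq ?_
        filter_upwards [Lp.coeFn_smul c a] with x hx
        rw [hx, Pi.smul_apply, Pi.smul_apply, smul_comm] }
  toFun :=
    { toFun := fun f => MemLp.toLp (fun x => φ x • (f : L2 h) x) f.2
      map_add' := by
        intro a b
        rw [← MemLp.toLp_add]
        refine MemLp.toLp_congr _ _ ?_
        filter_upwards [Lp.coeFn_add (a : L2 h) (b : L2 h)] with x hx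
        rw [Submodule.coe_add, hx, Pi.add_apply, Pi.add_apply, smul_add]
      map_smul' := by
        intro c a
        rw [RingHom.id_apply, ← MemLp.toLp_const_smul]
        refine MemLp.toLp_congr _ _ ?_
        filter_upwards [Lp.coeFn_smul c (a : L2 h)] with x hx
        rw [Submodule.coe_smul, hx, Pi.smul_apply, Pi.smul_apply, smul_comm] }

/-- The self-adjoint operator `M` of multiplication by the independent variable in `L²(ℝ; h)`; its
domain consists of the `f` with `∫ ‖f(x)‖² (x² + 1) dx < ∞`. Its functional calculus is
`φ(M) = mulOp h φ`. -/
def M (h : Type*) [NormedAddCommGroup h] [InnerProductSpace ℂ h] : L2 h →ₗ.[ℂ] L2 h :=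
  mulOp h (fun x : ℝ => (x : ℂ))

/-- The set `L^∞_comp(M)` of the `u` for which `d(E_M(-∞,x)u,u)/dx = ‖u(x)‖²` is bounded and compactly
supported. It is dense in `L²(ℝ; h)`, and `φ(M) u ∈ Dom M` for `u` in it and `φ ∈ L²(ℝ)`. -/
def LinftyComp (h : Type*) [NormedAddCommGroup h] : Set (L2 h) :=
  {u | ∃ R : ℝ, ∀ᵐ x : ℝ, ‖u x‖ ≤ R ∧ (R < |x| → u x = 0)}

/-- The bounded operator `T` is `G φ(M)`: it is the continuous extension of `u ↦ G (φ(M) u)`,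
`u ∈ L^∞_comp(M)`. By density there is at most one such `T`. -/
def IsComp (G : L2 h →ₗ.[ℂ] K) (φ : L2 ℂ) (T : L2 h →L[ℂ] K) : Prop :=
  ∀ u ∈ LinftyComp h, ∃ (hu : u ∈ (mulOp h φ).domain) (hG : mulOp h φ ⟨u, hu⟩ ∈ G.domain),
    T u = G ⟨mulOp h φ ⟨u, hu⟩, hG⟩

/-- `G ∈ Smooth(M)`: the operators `G φ(M)`, `φ ∈ L²(ℝ)`, are bounded with
`‖G φ(M)‖ ≤ C ‖φ‖`. -/
def Smooth (G : L2 h →ₗ.[ℂ] K) : Prop :=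
  ∃ C : ℝ≥0, ∀ φ : L2 ℂ, ∃ T : L2 h →L[ℂ] K, IsComp G φ T ∧ ‖T‖ ≤ C * ‖φ‖

/-- `G f = ∫ g(x) f(x) dx` for all `f ∈ Dom M`, as a convergent Bochner integral in `K`
(convergence is automatic if `g` is measurable and essentially bounded). -/
def Represents (g : ℝ → h →L[ℂ] K) (G : L2 h →ₗ.[ℂ] K) : Prop :=
  ∀ f ∈ (M h).domain, ∃ hG : f ∈ G.domain,
    Integrable (fun x => g x (f x)) (volume : Measure ℝ) ∧ G ⟨f, hG⟩ = ∫ x : ℝ, g x (f x)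

variable [CompleteSpace h] [CompleteSpace K]

/-- `‖G φ(M)‖_p`, understood as `∞` if `G φ(M)` is unbounded (the infimum is over at most one
operator). -/
def compSchattenNorm (p : ℝ) (G : L2 h →ₗ.[ℂ] K) (φ : L2 ℂ) : ℝ≥0∞ :=
  ⨅ (T : L2 h →L[ℂ] K) (_ : IsComp G φ T), schattenNorm p T

/-- `G ∈ Smooth_p(M)`. -/
def SmoothP (p : ℝ) (G : L2 h →ₗ.[ℂ] K) : Prop :=
  Smooth G ∧ ∃ C : ℝ≥0, ∀ φ : L2 ℂ, compSchattenNorm p G φ ≤ C * ‖φ‖ₑ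

/-- `‖G‖_{Smooth_p(M)} = sup {‖G φ(M)‖_p : ‖φ‖ = 1}`. -/
def smoothPNorm (p : ℝ) (G : L2 h →ₗ.[ℂ] K) : ℝ≥0∞ :=
  ⨆ (φ : L2 ℂ) (_ : ‖φ‖ = 1), compSchattenNorm p G φ

end KatoSmooth

end

/-! The link between $G$ and $g$ is testing on short intervals. Relative boundedness makes
$S=G(\mathcal M-i)^{-1}$ bounded, so each $k\in\mathcal K$ has a locally integrable $\beta_k$ with
$\langle k,Gf\rangle=\int\langle\beta_k(x),f(x)\rangle\,dx$ (`exists_isWeakDensity`). If $\varphi$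
is the $L^2$-normalized indicator of $[x-r,x+r]$, then $a\mapsto\varphi\otimes a$ is isometric and
the adjoint of $a\mapsto G\varphi(\mathcal M)(\varphi\otimes a)$ sends $k$ to the average of
$\beta_k$ over the interval. These operators have $p$-norm at most $\|G\|_{\mathrm{Smooth}_p}$. As
$r\to0$, Lebesgue differentiation on a countable dense set of $k$, together with a uniform operator
bound, gives for almost every $x$ a weak limit $g(x)$ with $g(x)^*k=\beta_k(x)$ on that set
(`IsWeakDensity.ae_exists`).

The norm bound survives the limit for every $p>0$, including $p<1$ where duality fails: the number
of singular values above $t$ is weakly lower semicontinuous (`singCount_le_liminf`), and the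
$p$-norm is an integral of this number over $t$, so Fatou applies. Compactness of the values makes
$g$ measurable in operator norm.

Conversely, let $p\ge2$. The adjoint of $G\varphi(\mathcal M)$ is $k\mapsto\bar\varphi\,g^*k$.
Jensen's inequality with exponent $p/2$ for the measure $|\varphi|^2dx$ bounds
$\sum_k\|\bar\varphi\,g^*e_k\|^p$ over orthonormal $e_k$ by averages of
$\sum_k\|g(x)^*e_k\|^p\le\|g(x)\|_p^p$ (`schattenNorm_adjoint_le`). Equality of norms follows
because the differentiation argument recovers any given $g$ almost everywhere.

For $p<2$ take $g(x)$ to be the projection onto $e_n$ for $n\le|x|<n+1$, and $\varphi=(n+1)^{-1/p}$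
there. Then $\varphi\in L^2$, but the singular values of $G\varphi(\mathcal M)$ dominate
$(n+1)^{-1/p}$, whose $p$-th powers form the harmonic series. -/

noncomputable section

namespace KatoSmooth

open Filter Topology Module

set_option linter.unusedSectionVars false

/-! ### Criteria for compactness. -/

section CompactOperators

variable {E F : Type*} [NormedAddCommGroup E] [InnerProductSpace ℂ E] [CompleteSpace E]
  [NormedAddCommGroup F] [InnerProductSpace ℂ F] [CompleteSpace F]

theorem norm_sq_le_norm_adjoint_comp_mul (A : E →L[ℂ] F) (x : E) :
    ‖A x‖ ^ 2 ≤ ‖(A.adjoint ∘L A) x‖ * ‖x‖ := by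
  have h1 : ‖A x‖ ^ 2 = RCLike.re (inner ℂ ((A.adjoint ∘L A) x) x) :=
    ContinuousLinearMap.apply_norm_sq_eq_inner_adjoint_left A x
  rw [h1]
  exact (RCLike.re_le_norm _).trans (norm_inner_le_norm _ _)

/-- On the unit ball $\|A(x-x')\|^2\le2\|A^*A(x-x')\|$, so a fine finite cover of the image under
$A^*A$ yields one for the image under $A$. -/
theorem isCompactOperator_of_adjoint_comp {A : E →L[ℂ] F}
    (h : IsCompactOperator (A.adjoint ∘L A : E →L[ℂ] E)) : IsCompactOperator A := by
  have key : TotallyBounded (A '' Metric.closedBall 0 1) := by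
    refine Metric.totallyBounded_of_finite_discretization fun ε hε => ?_
    have hT : TotallyBounded ((A.adjoint ∘L A : E →L[ℂ] E) '' Metric.closedBall 0 1) :=
      (IsCompactOperator.isCompact_closure_image_closedBall
        (f := ((A.adjoint ∘L A : E →L[ℂ] E) : E →ₗ[ℂ] E)) h 1).totallyBounded.subset subset_closure
    -- Two points with images in one such ball satisfy $\|A^*A(x-x')\|<\varepsilon^2/4$ and
    -- $\|x-x'\|\le2$, hence $\|A(x-x')\|^2\le\varepsilon^2/2$.
    obtain ⟨t, ht, hcov⟩ := Metric.totallyBounded_iff.1 hT (ε ^ 2 / 8) (by positivity)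
    have hc : ∀ y : A '' Metric.closedBall 0 1, ∃ (x : E) (z : t), A x = y ∧ ‖x‖ ≤ 1 ∧
        dist ((A.adjoint ∘L A) x) z < ε ^ 2 / 8 := by
      rintro ⟨_, x, hx, rfl⟩
      have := hcov ⟨x, hx, rfl⟩
      simp only [Set.mem_iUnion, Metric.mem_ball, exists_prop] at this
      obtain ⟨z, hz, hd⟩ := this
      exact ⟨x, ⟨z, hz⟩, rfl, by simpa using hx, hd⟩
    choose X Z hX hX1 hd using hc
    have : Finite t := ht
    let eqv := Finite.equivFin t
    refine ⟨ULift (Fin (Nat.card t)), inferInstance, fun y => ⟨eqv (Z y)⟩, fun y y' hyy => ?_⟩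
    have hZ : Z y = Z y' := eqv.injective (congrArg ULift.down hyy)
    have h1 := hd y
    have h2 := hd y'
    rw [← hZ] at h2
    have h3 : ‖(A.adjoint ∘L A) (X y - X y')‖ < ε ^ 2 / 4 := by
      rw [map_sub, ← dist_eq_norm]
      calc _ ≤ _ := dist_triangle_right _ _ (Z y : E)
        _ < _ := by linarith
    have h4 : ‖X y - X y'‖ ≤ 2 := (norm_sub_le _ _).trans (by linarith [hX1 y, hX1 y'])
    have h5 := norm_sq_le_norm_adjoint_comp_mul A (X y - X y')
    rw [dist_eq_norm, ← hX y, ← hX y', ← map_sub]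
    refine lt_of_pow_lt_pow_left₀ 2 hε.le ?_
    nlinarith [norm_nonneg ((A.adjoint ∘L A) (X y - X y'))]
  refine (isCompactOperator_iff_isCompact_closure_image_closedBall (A : E →ₗ[ℂ] F) one_pos).2 ?_
  exact key.closure.isCompact_of_isClosed isClosed_closure

theorem isCompactOperator_adjoint {A : E →L[ℂ] F} (h : IsCompactOperator A) :
    IsCompactOperator A.adjoint := by
  apply isCompactOperator_of_adjoint_comp
  rw [ContinuousLinearMap.adjoint_adjoint]
  exact h.comp_clm A.adjoint

theorem isCompactOperator_of_isCompactOperator_adjoint {A : E →L[ℂ] F}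
    (h : IsCompactOperator A.adjoint) : IsCompactOperator A := by
  simpa using isCompactOperator_adjoint h

/-- An operator which is small outside finite-dimensional subspaces is compact. -/
theorem isCompactOperator_of_forall_exists_finiteDimensional {A : E →L[ℂ] F}
    (H : ∀ t : ℝ, 0 < t → ∃ U : Submodule ℂ E, FiniteDimensional ℂ U ∧
      ∀ v ∈ Uᗮ, ‖A v‖ ≤ t * ‖v‖) : IsCompactOperator A := by
  choose! U hU hUA using H
  have hpos : ∀ n : ℕ, (0 : ℝ) < 1 / ((n : ℝ) + 1) := fun n => Nat.one_div_pos_of_nat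
  have hfd : ∀ n : ℕ, FiniteDimensional ℂ (U (1 / ((n : ℝ) + 1))) := fun n => hU _ (hpos n)
  let B : ℕ → E →L[ℂ] F := fun n => A ∘L (U (1 / ((n : ℝ) + 1))).starProjection
  have hB : Tendsto B atTop (𝓝 A) := by
    rw [tendsto_iff_norm_sub_tendsto_zero]
    refine squeeze_zero (fun _ => norm_nonneg _) (fun n => ?_)
      tendsto_one_div_add_atTop_nhds_zero_nat
    refine ContinuousLinearMap.opNorm_le_bound _ (hpos n).le fun x => ?_
    have h1 : (B n - A) x = - A (x - (U (1 / ((n : ℝ) + 1))).starProjection x) := by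
      simp [B]
    rw [h1, norm_neg]
    refine (hUA _ (hpos n) _ (Submodule.sub_starProjection_mem_orthogonal x)).trans ?_
    gcongr
    rw [← Submodule.starProjection_orthogonal_val]
    exact Submodule.norm_starProjection_apply_le _ x
  refine isCompactOperator_of_tendsto hB (Eventually.of_forall fun n => ?_)
  have : B n = (A ∘L (U (1 / ((n : ℝ) + 1))).subtypeL) ∘L
    (U (1 / ((n : ℝ) + 1))).orthogonalProjectionOnto := rfl
  rw [this]
  have hc : IsCompactOperator (A ∘L (U (1 / ((n : ℝ) + 1))).subtypeL) :=
    isCompactOperator_of_locallyCompactSpace_rng _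
  exact hc.comp_clm _

/-- If $A$ is not small off any finite-dimensional subspace, a greedy choice produces an infinite
orthonormal sequence with orthogonal images of norm above $t$. -/
theorem isCompactOperator_of_orthonormal_bound {A : E →L[ℂ] F}
    (H : ∀ t : ℝ, 0 < t → ∃ n : ℕ, ∀ e : Fin n → E, Orthonormal ℂ e →
      (Pairwise fun i j => inner ℂ (A (e i)) (A (e j)) = 0) → ∃ i, ‖A (e i)‖ ≤ t) :
    IsCompactOperator A := by
  refine isCompactOperator_of_forall_exists_finiteDimensional fun t ht => ?_
  by_contra! hcon
  obtain ⟨n, hn⟩ := H t ht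
  have hsymm : Std.Symm fun x y : E => inner ℂ x y = 0 ∧ inner ℂ (A x) (A y) = 0 :=
    ⟨fun x y hxy => ⟨inner_eq_zero_symm.1 hxy.1, inner_eq_zero_symm.1 hxy.2⟩⟩
  obtain ⟨f, hf1, hf2⟩ := exists_seq_of_forall_finset_exists'
    (fun x : E => ‖x‖ = 1 ∧ t < ‖A x‖)
    (fun x y : E => inner ℂ x y = 0 ∧ inner ℂ (A x) (A y) = 0) (by
      intro s _
      obtain ⟨v, hv, hlt⟩ := hcon
        -- Orthogonality to $A^*Ax$ is what makes $Av$ orthogonal to $Ax$.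
        (Submodule.span ℂ ((s : Set E) ∪ (A.adjoint ∘L A) '' s))
        (FiniteDimensional.span_of_finite ℂ (s.finite_toSet.union (s.finite_toSet.image _)))
      have hv0 : v ≠ 0 := by rintro rfl; simp at hlt
      have hvn : 0 < ‖v‖ := norm_pos_iff.2 hv0
      have hort : ∀ u ∈ Submodule.span ℂ ((s : Set E) ∪ (A.adjoint ∘L A) '' s),
          inner ℂ u v = 0 := fun u hu => hv u hu
      refine ⟨((‖v‖⁻¹ : ℝ) : ℂ) • v, ⟨?_, ?_⟩, fun x hx => ⟨?_, ?_⟩⟩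
      · rw [norm_smul, Complex.norm_real, norm_inv, norm_norm, inv_mul_cancel₀ hvn.ne']
      · rw [map_smul, norm_smul, Complex.norm_real, norm_inv, norm_norm, ← div_eq_inv_mul,
          lt_div_iff₀ hvn]
        exact hlt
      · rw [inner_smul_right, hort x (Submodule.subset_span (Or.inl hx)), mul_zero]
      · rw [map_smul, inner_smul_right, ← ContinuousLinearMap.adjoint_inner_left,
          show inner ℂ (A.adjoint (A x)) v = 0 from
            hort _ (Submodule.subset_span (Or.inr ⟨x, hx, rfl⟩)), mul_zero])
  obtain ⟨i, hi⟩ := hn (fun i => f i)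
    ⟨fun i => (hf1 i).1, fun i j hij => (hf2 (fun h => hij (Fin.ext h))).1⟩
    (fun i j hij => (hf2 (fun h => hij (Fin.ext h))).2)
  exact absurd (hf1 i).2 (not_lt.2 hi)

end CompactOperators

/-! ### Singular value decomposition of a compact operator. -/

section SingularSystem

variable {E F : Type*} [NormedAddCommGroup E] [InnerProductSpace ℂ E] [CompleteSpace E]
  [NormedAddCommGroup F] [InnerProductSpace ℂ F] [CompleteSpace F]

/-- A singular value decomposition `A = ∑ sᵢ ⟨vᵢ, ·⟩ wᵢ` with positive `sᵢ`. -/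
structure IsSingularSystem (A : E →L[ℂ] F) {ι : Type*} (v : ι → E) (w : ι → F) (s : ι → ℝ) :
    Prop where
  pos : ∀ i, 0 < s i
  orthonormal_left : Orthonormal ℂ v
  orthonormal_right : Orthonormal ℂ w
  apply_eq : ∀ i, A (v i) = (s i : ℂ) • w i
  adjoint_apply_eq : ∀ i, A.adjoint (w i) = (s i : ℂ) • v i
  eq_zero : ∀ x, (∀ i, inner ℂ (v i) x = 0) → A x = 0

/-- After extending $v$ to a Hilbert basis, the added vectors are killed by $A$ and drop out of the
expansion. -/
theorem hasSum_inner_smul_apply {A : E →L[ℂ] F} {ι : Type*} {v : ι → E} (hv : Orthonormal ℂ v)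
    (h0 : ∀ x, (∀ i, inner ℂ (v i) x = 0) → A x = 0) (x : E) :
    HasSum (fun i => inner ℂ (v i) x • A (v i)) (A x) := by
  obtain ⟨W, b, hW, hb⟩ := hv.toSubtypeRange.exists_hilbertBasis_extension
  have h1 : HasSum (fun i : W => inner ℂ (i : E) x • A i) (A x) := by
    have h := (b.hasSum_repr x).mapL A
    simpa [b.repr_apply_apply, hb] using h
  have hinj : Function.Injective fun i => (⟨v i, hW ⟨i, rfl⟩⟩ : W) := fun i j hij =>
    hv.linearIndependent.injective (congrArg Subtype.val hij)
  refine (hinj.hasSum_iff ?_).2 h1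
  intro y hy
  rw [h0 y, smul_zero]
  intro i
  have hne : (⟨v i, hW ⟨i, rfl⟩⟩ : W) ≠ y := fun h => hy ⟨i, h⟩
  have := b.orthonormal.2 hne
  simpa [hb] using this

theorem norm_sq_sum_smul {ι : Type*} {w : ι → F} (hw : Orthonormal ℂ w) (c : ι → ℂ)
    (s : Finset ι) : ‖∑ i ∈ s, c i • w i‖ ^ 2 = ∑ i ∈ s, ‖c i‖ ^ 2 := by
  have h := hw.inner_sum c c s
  rw [inner_self_eq_norm_sq_to_K] at h
  have h2 : ∀ i ∈ s, (starRingEnd ℂ) (c i) * c i = ((‖c i‖ ^ 2 : ℝ) : ℂ) := fun i _ => by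
    rw [mul_comm, Complex.mul_conj, Complex.normSq_eq_norm_sq]
  rw [Finset.sum_congr rfl h2] at h
  exact Complex.ofReal_injective (by push_cast at h ⊢; exact h)

theorem IsSingularSystem.adjoint_eq_zero {A : E →L[ℂ] F} {ι : Type*} {v : ι → E} {w : ι → F}
    {s : ι → ℝ} (h : IsSingularSystem A v w s) (y : F) (hy : ∀ i, inner ℂ (w i) y = 0) :
    A.adjoint y = 0 := by
  refine ext_inner_right ℂ fun x => ?_
  rw [ContinuousLinearMap.adjoint_inner_left, inner_zero_left]
  have h1 := (hasSum_inner_smul_apply h.orthonormal_left h.eq_zero x).mapL (innerSL ℂ y)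
  refine h1.unique ?_
  convert hasSum_zero using 2 with i
  rw [innerSL_apply_apply, h.apply_eq, inner_smul_right, inner_smul_right,
    inner_eq_zero_symm.1 (hy i)]
  simp

theorem IsSingularSystem.adjoint {A : E →L[ℂ] F} {ι : Type*} {v : ι → E} {w : ι → F}
    {s : ι → ℝ} (h : IsSingularSystem A v w s) : IsSingularSystem A.adjoint w v s where
  pos := h.pos
  orthonormal_left := h.orthonormal_right
  orthonormal_right := h.orthonormal_left
  apply_eq := h.adjoint_apply_eq
  adjoint_apply_eq := by simpa using h.apply_eq
  eq_zero := h.adjoint_eq_zero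

theorem IsSingularSystem.hasSum {A : E →L[ℂ] F} {ι : Type*} {v : ι → E} {w : ι → F}
    {s : ι → ℝ} (h : IsSingularSystem A v w s) (x : E) :
    HasSum (fun i => ((s i : ℂ) * inner ℂ (v i) x) • w i) (A x) := by
  have := hasSum_inner_smul_apply h.orthonormal_left h.eq_zero x
  convert this using 2 with i
  rw [h.apply_eq, smul_smul, mul_comm]

theorem IsSingularSystem.norm_sq_le {A : E →L[ℂ] F} {ι : Type*} {v : ι → E} {w : ι → F}
    {s : ι → ℝ} (h : IsSingularSystem A v w s) (x : E) {c : ℝ}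
    (hc : ∀ S : Finset ι, ∑ i ∈ S, s i ^ 2 * ‖inner ℂ (v i) x‖ ^ 2 ≤ c) : ‖A x‖ ^ 2 ≤ c := by
  have h1 : Tendsto (fun S : Finset ι => ‖∑ i ∈ S, ((s i : ℂ) * inner ℂ (v i) x) • w i‖ ^ 2)
      atTop (𝓝 (‖A x‖ ^ 2)) := (h.hasSum x).norm.pow 2
  refine le_of_tendsto' h1 fun S => ?_
  rw [norm_sq_sum_smul h.orthonormal_right]
  refine le_trans (le_of_eq (Finset.sum_congr rfl fun i _ => ?_)) (hc S)
  rw [norm_mul, mul_pow, Complex.norm_real, Real.norm_eq_abs, sq_abs]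

/-- A compact operator has a singular value decomposition, and its Schatten norms are the
`ℓ^p`-norms of the singular values. -/
theorem exists_isSingularSystem {A : E →L[ℂ] F} (hA : IsCompactOperator A) :
    ∃ (ι : Type) (v : ι → E) (w : ι → F) (s : ι → ℝ), IsSingularSystem A v w s ∧
      ∀ p : ℝ, 0 < p → schattenNorm p A ^ p = ∑' i, ENNReal.ofReal (s i ^ p) := by
  set T : E →L[ℂ] E := A.adjoint ∘L A with hT
  have hTc : IsCompactOperator T := hA.clm_comp A.adjoint
  have hTs : (T : E →ₗ[ℂ] E).IsSymmetric := fun x y => by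
    simp only [hT, ContinuousLinearMap.coe_coe, ContinuousLinearMap.coe_comp, Function.comp_apply]
    rw [ContinuousLinearMap.adjoint_inner_left, ContinuousLinearMap.adjoint_inner_right]
  -- The singular vectors are indexed by a positive singular value $r$ and a position in an
  -- orthonormal basis of the eigenspace of $A^*A$ for $r^2$.
  let μ : {r : ℝ≥0 // 0 < r} → ℂ := fun r => (((r : ℝ≥0) : ℝ) : ℂ) ^ 2
  have hμinj : Function.Injective μ := by
    intro a b hab
    have h1 : ((a : ℝ≥0) : ℝ) ^ 2 = ((b : ℝ≥0) : ℝ) ^ 2 := by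
      simp only [μ] at hab; exact_mod_cast hab
    have h2 := (pow_left_inj₀ (a : ℝ≥0).2 (b : ℝ≥0).2 two_ne_zero).1 h1
    exact Subtype.ext (NNReal.coe_injective h2)
  have hμ0 : ∀ r, μ r ≠ 0 := fun r => by
    have : ((r : ℝ≥0) : ℝ) ≠ 0 := by exact_mod_cast r.2.ne'
    simpa [μ] using this
  have hfd : ∀ r : {r : ℝ≥0 // 0 < r}, FiniteDimensional ℂ (Module.End.eigenspace (T : E →ₗ[ℂ] E) (μ r)) := fun r =>
    ContinuousLinearMap.finite_dimensional_eigenspace hTc _ (hμ0 r)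
  let b : ∀ r : {r : ℝ≥0 // 0 < r}, OrthonormalBasis (Fin (singularMult A r)) ℂ
      (Module.End.eigenspace (T : E →ₗ[ℂ] E) (μ r)) := fun r => stdOrthonormalBasis ℂ _
  let v : (Σ r : {r : ℝ≥0 // 0 < r}, Fin (singularMult A r)) → E := fun i => b i.1 i.2
  let s : (Σ r : {r : ℝ≥0 // 0 < r}, Fin (singularMult A r)) → ℝ := fun i => (i.1 : ℝ≥0)
  have hs : ∀ i, 0 < s i := fun i => by exact_mod_cast i.1.2
  have hsC : ∀ i, (s i : ℂ) ≠ 0 := fun i => by exact_mod_cast (hs i).ne'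
  have hv : Orthonormal ℂ v :=
    (hTs.orthogonalFamily_eigenspaces.comp hμinj).orthonormal_sigma_orthonormal
      fun r => (b r).orthonormal
  have hTv : ∀ i, A.adjoint (A (v i)) = (s i : ℂ) ^ 2 • v i := fun i =>
    Module.End.mem_eigenspace_iff.1 (b i.1 i.2).2
  let w : (Σ r : {r : ℝ≥0 // 0 < r}, Fin (singularMult A r)) → F :=
    fun i => (s i : ℂ)⁻¹ • A (v i)
  have hAv : ∀ i, A (v i) = (s i : ℂ) • w i := fun i => by
    simp only [w]; rw [smul_inv_smul₀ (hsC i)]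
  have hAw : ∀ i, A.adjoint (w i) = (s i : ℂ) • v i := fun i => by
    simp only [w]; rw [map_smul, hTv, smul_smul]; congr 1
    field_simp [hsC i]
  have hw : Orthonormal ℂ w := by
    classical
    rw [orthonormal_iff_ite] at hv ⊢
    intro i j
    have : inner ℂ (w i) (w j) = (s j : ℂ)⁻¹ * ((s i : ℂ) * inner ℂ (v i) (v j)) := by
      conv_lhs => rw [show w j = (s j : ℂ)⁻¹ • A (v j) from rfl]
      rw [inner_smul_right, ← ContinuousLinearMap.adjoint_inner_left, hAw, inner_smul_left]
      simp
    rw [this, hv]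
    split_ifs with hij
    · subst hij; field_simp [hsC i]
    · simp
  refine ⟨_, v, w, s, ⟨hs, hv, hw, hAv, hAw, fun x hx => ?_⟩, fun p hp => ?_⟩
  -- The eigenspaces of the compact self-adjoint $T$ span a dense subspace, so orthogonality of $Tx$
  -- to all of them gives $Tx=0$ and then $Ax=0$. For the kernel this is symmetry of $T$; for the
  -- others it comes from $x\perp v_i$.
  · have hTx : T x ∈ (⨆ μ, Module.End.eigenspace (T : E →ₗ[ℂ] E) μ)ᗮ := by
      rw [← Submodule.iInf_orthogonal, Submodule.mem_iInf]
      refine fun ν => (Submodule.mem_orthogonal _ _).2 fun y hy => ?_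
      have hTy : T y = ν • y := Module.End.mem_eigenspace_iff.1 hy
      have hsym : inner ℂ y (T x) = (starRingEnd ℂ) ν * inner ℂ y x := by
        rw [← inner_smul_left, ← hTy]; exact (hTs y x).symm
      rw [hsym]
      by_cases hν : ν = 0
      · simp [hν]
      by_cases hy0 : y = 0
      · simp [hy0]
      have hyn : 0 < ‖y‖ := norm_pos_iff.2 hy0
      have hνy : ν * (‖y‖ : ℂ) ^ 2 = (‖A y‖ : ℂ) ^ 2 := by
        have h1 : inner ℂ y (T y) = ν * (‖y‖ : ℂ) ^ 2 := by
          rw [hTy, inner_smul_right, inner_self_eq_norm_sq_to_K]; rfl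
        rw [← h1]
        simp only [hT, ContinuousLinearMap.coe_comp, Function.comp_apply]
        rw [ContinuousLinearMap.adjoint_inner_right, inner_self_eq_norm_sq_to_K]; rfl
      have hAy : 0 < ‖A y‖ := by
        rw [norm_pos_iff]
        intro h0
        rw [h0, norm_zero] at hνy
        have : (‖y‖ : ℂ) ≠ 0 := by exact_mod_cast hyn.ne'
        simp [hν, this] at hνy
      -- The identity $\nu\|y\|^2=\|Ay\|^2$ forces $\nu=r^2$ with this $r$, so $y$ lies in one of
      -- the enumerated eigenspaces.
      let r : {r : ℝ≥0 // 0 < r} := ⟨‖A y‖₊ / ‖y‖₊, div_pos hAy hyn⟩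
      have hr : ν = μ r := by
        have : (‖y‖ : ℂ) ≠ 0 := by exact_mod_cast hyn.ne'
        simp only [μ, r, NNReal.coe_div, coe_nnnorm, Complex.ofReal_div, div_pow]
        rw [← hνy]; field_simp
      have hy' : y ∈ Module.End.eigenspace (T : E →ₗ[ℂ] E) (μ r) := hr ▸ hy
      have hsum : y = ∑ k, (b r).repr ⟨y, hy'⟩ k • v ⟨r, k⟩ := by
        have := congrArg (Submodule.subtype _) ((b r).sum_repr ⟨y, hy'⟩)
        rw [map_sum] at this
        simpa [v] using this.symm
      have : inner ℂ y x = 0 := by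
        rw [hsum, sum_inner]
        exact Finset.sum_eq_zero fun k _ => by rw [inner_smul_left, hx, mul_zero]
      rw [this, mul_zero]
    rw [ContinuousLinearMap.orthogonalComplement_iSup_eigenspaces_eq_bot hTc hTs,
      Submodule.mem_bot] at hTx
    have := norm_sq_le_norm_adjoint_comp_mul A x
    rw [show (A.adjoint ∘L A) x = T x from rfl, hTx, norm_zero, zero_mul] at this
    exact norm_eq_zero.1 (pow_eq_zero_iff two_ne_zero |>.1 (le_antisymm this (sq_nonneg _)))
  · rw [schattenNorm, if_pos hA, ← ENNReal.rpow_mul, one_div_mul_cancel hp.ne', ENNReal.rpow_one,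
      ENNReal.tsum_sigma']
    have h1 : ∀ r : {r : ℝ≥0 // 0 < r}, ∑' k : Fin (singularMult A r),
        ENNReal.ofReal (s ⟨r, k⟩ ^ p) =
          (singularMult A r : ℝ≥0∞) * ((r : ℝ≥0) : ℝ≥0∞) ^ p := fun r => by
      rw [tsum_fintype]
      simp only [s, Finset.sum_const, Finset.card_univ, Fintype.card_fin, nsmul_eq_mul]
      rw [← ENNReal.ofReal_rpow_of_nonneg (NNReal.coe_nonneg _) hp.le, ENNReal.ofReal_coe_nnreal]
    simp_rw [h1]
    refine (tsum_subtype_eq_of_support_subset (s := {r : ℝ≥0 | 0 < r})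
      (f := fun r : ℝ≥0 => (singularMult A r : ℝ≥0∞) * (r : ℝ≥0∞) ^ p) ?_).symm
    intro r hr
    simp only [Set.mem_ofPred_eq]
    refine pos_iff_ne_zero.2 fun h0 => hr ?_
    simp [h0, ENNReal.zero_rpow_of_pos hp]

end SingularSystem

/-! ### Counting singular values, and lower semicontinuity of Schatten norms. -/

section SingularCount

variable {E F : Type*} [NormedAddCommGroup E] [InnerProductSpace ℂ E] [CompleteSpace E]
  [NormedAddCommGroup F] [InnerProductSpace ℂ F] [CompleteSpace F]

/-- The number of singular values of `A` above the level `t`, given by a variational formula which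
makes sense for every bounded operator. -/
def singCount (A : E →L[ℂ] F) (t : ℝ) : ℝ≥0∞ :=
  ⨆ (V : Submodule ℂ E) (_ : FiniteDimensional ℂ V) (_ : ∀ v ∈ V, v ≠ 0 → t * ‖v‖ < ‖A v‖),
    (finrank ℂ V : ℝ≥0∞)

theorem finrank_le_singCount {A : E →L[ℂ] F} {t : ℝ} (V : Submodule ℂ E) [FiniteDimensional ℂ V]
    (hV : ∀ v ∈ V, v ≠ 0 → t * ‖v‖ < ‖A v‖) : (finrank ℂ V : ℝ≥0∞) ≤ singCount A t :=
  le_iSup_of_le V (le_iSup_of_le inferInstance (le_iSup_of_le hV le_rfl))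

theorem singCount_le {A : E →L[ℂ] F} {t : ℝ} {c : ℝ≥0∞}
    (h : ∀ V : Submodule ℂ E, FiniteDimensional ℂ V → (∀ v ∈ V, v ≠ 0 → t * ‖v‖ < ‖A v‖) →
      (finrank ℂ V : ℝ≥0∞) ≤ c) : singCount A t ≤ c :=
  iSup_le fun V => iSup_le fun hV => iSup_le fun hV' => h V hV hV'

theorem singCount_anti (A : E →L[ℂ] F) : Antitone (singCount A) := fun _ _ hst =>
  singCount_le fun V _ hV' => finrank_le_singCount V fun v hv h0 =>
    (mul_le_mul_of_nonneg_right hst (norm_nonneg v)).trans_lt (hV' v hv h0)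

/-- The span of the $e_i$ is an admissible subspace: by Pythagoras in domain and target,
$\|Ax\|>t\|x\|$ for every nonzero combination. -/
theorem card_le_singCount {A : E →L[ℂ] F} {t : ℝ} (ht : 0 ≤ t) {ι : Type*} [Fintype ι] {e : ι → E}
    (he : Orthonormal ℂ e) (hAe : Pairwise fun i j => inner ℂ (A (e i)) (A (e j)) = 0)
    (hlt : ∀ i, t < ‖A (e i)‖) : (Fintype.card ι : ℝ≥0∞) ≤ singCount A t := by
  have hpos : ∀ i, 0 < ‖A (e i)‖ := fun i => ht.trans_lt (hlt i)
  let w : ι → F := fun i => ((‖A (e i)‖ : ℝ) : ℂ)⁻¹ • A (e i)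
  have hne : ∀ i, ((‖A (e i)‖ : ℝ) : ℂ) ≠ 0 := fun i => by exact_mod_cast (hpos i).ne'
  have hw : Orthonormal ℂ w := by
    refine ⟨fun i => ?_, fun i j hij => ?_⟩
    · simp only [w]
      rw [norm_smul, norm_inv, Complex.norm_real, norm_norm, inv_mul_cancel₀ (hpos i).ne']
    · simp only [w]
      rw [inner_smul_left, inner_smul_right, hAe hij]; simp
  have hAw : ∀ i, A (e i) = ((‖A (e i)‖ : ℝ) : ℂ) • w i := fun i => by
    simp only [w]; rw [smul_inv_smul₀ (hne i)]
  have hfr := finrank_span_eq_card (R := ℂ) he.linearIndependent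
  have : FiniteDimensional ℂ (Submodule.span ℂ (Set.range e)) :=
    FiniteDimensional.span_of_finite ℂ (Set.finite_range e)
  rw [← hfr]
  refine finrank_le_singCount _ fun x hx hx0 => ?_
  obtain ⟨c, rfl⟩ := (Submodule.mem_span_range_iff_exists_fun ℂ).1 hx
  have h1 : A (∑ i, c i • e i) = ∑ i, (c i * (‖A (e i)‖ : ℝ)) • w i := by
    rw [map_sum]
    refine Finset.sum_congr rfl fun i _ => ?_
    rw [map_smul, mul_smul, ← hAw]
  refine lt_of_pow_lt_pow_left₀ 2 (norm_nonneg _) ?_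
  rw [h1, norm_sq_sum_smul hw, mul_pow, norm_sq_sum_smul he, Finset.mul_sum]
  obtain ⟨j, hj⟩ : ∃ j, c j ≠ 0 := by
    by_contra! h
    exact hx0 (Finset.sum_eq_zero fun i _ => by rw [h i, zero_smul])
  have hterm : ∀ i, ‖c i * ((‖A (e i)‖ : ℝ) : ℂ)‖ ^ 2 = ‖A (e i)‖ ^ 2 * ‖c i‖ ^ 2 := fun i => by
    rw [norm_mul, Complex.norm_real, norm_norm]; ring
  simp_rw [hterm]
  refine Finset.sum_lt_sum (fun i _ => ?_) ⟨j, Finset.mem_univ j, ?_⟩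
  · gcongr; exact (hlt i).le
  · have : 0 < ‖c j‖ := norm_pos_iff.2 hj
    have := hlt j
    gcongr

theorem encard_le_singCount {A : E →L[ℂ] F} {t : ℝ} (ht : 0 ≤ t) {ι : Type*} {e : ι → E}
    (he : Orthonormal ℂ e) (hAe : Pairwise fun i j => inner ℂ (A (e i)) (A (e j)) = 0) :
    ({i | t < ‖A (e i)‖}.encard : ℝ≥0∞) ≤ singCount A t := by
  have key : ∀ S : Finset ι, (∀ i ∈ S, t < ‖A (e i)‖) → (S.card : ℝ≥0∞) ≤ singCount A t := by
    intro S hS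
    have := card_le_singCount (A := A) (ι := S) ht (he.comp _ Subtype.val_injective)
      (fun i j hij => hAe (fun h => hij (Subtype.ext h))) (fun i => hS i i.2)
    simpa using this
  by_cases hfin : {i | t < ‖A (e i)‖}.Finite
  · rw [hfin.encard_eq_coe_toFinset_card]
    simpa using key hfin.toFinset fun i hi => by simpa using hi
  · have hinf : singCount A t = ⊤ := by
      refine ENNReal.eq_top_of_forall_nnreal_le fun r => ?_
      obtain ⟨n, hn⟩ := exists_nat_ge r
      obtain ⟨S, hS, hc⟩ := Set.Infinite.exists_subset_card_eq hfin n
      calc (r : ℝ≥0∞) ≤ (n : ℝ≥0∞) := by exact_mod_cast hn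
        _ = (S.card : ℝ≥0∞) := by rw [hc]
        _ ≤ _ := key S fun i hi => hS hi
    rw [hinf]; exact le_top

/-- Min-max principle. A vector orthogonal to all $v_i$ with $s_i>t$ satisfies $\|Ax\|\le t\|x\|$,
so on an admissible $V$ the coordinates along these $v_i$ are injective. The $v_i$ themselves give
the opposite bound. -/
theorem IsSingularSystem.singCount_eq {A : E →L[ℂ] F} {ι : Type*} {v : ι → E} {w : ι → F}
    {s : ι → ℝ} (h : IsSingularSystem A v w s) {t : ℝ} (ht : 0 ≤ t) :
    singCount A t = ({i | t < s i}.encard : ℝ≥0∞) := by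
  have hnorm : ∀ i, ‖A (v i)‖ = s i := fun i => by
    rw [h.apply_eq, norm_smul, h.orthonormal_right.1, mul_one, Complex.norm_real,
      Real.norm_of_nonneg (h.pos i).le]
  refine le_antisymm ?_ ?_
  · by_cases hfin : {i | t < s i}.Finite
    swap
    · rw [Set.encard_eq_top_iff.2 hfin]; exact le_top
    refine singCount_le fun V hV hV' => ?_
    rw [hfin.encard_eq_coe_toFinset_card]
    let φ : V →ₗ[ℂ] (hfin.toFinset → ℂ) :=
      LinearMap.pi fun i => (innerSL ℂ (v i) : E →ₗ[ℂ] ℂ) ∘ₗ V.subtype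
    have hφ : Function.Injective φ := by
      rw [injective_iff_map_eq_zero]
      rintro ⟨x, hx⟩ hx0
      have hx1 : ∀ i, t < s i → inner ℂ (v i) x = 0 := fun i hi =>
        congrFun hx0 ⟨i, hfin.mem_toFinset.2 hi⟩
      by_contra hne
      have hlt := hV' x hx fun h0 => hne (Subtype.ext h0)
      refine absurd hlt (not_lt.2 ?_)
      refine le_of_sq_le_sq ?_ (by positivity)
      refine h.norm_sq_le x fun S => ?_
      rw [mul_pow]
      calc ∑ i ∈ S, s i ^ 2 * ‖inner ℂ (v i) x‖ ^ 2
          ≤ ∑ i ∈ S, t ^ 2 * ‖inner ℂ (v i) x‖ ^ 2 := by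
            refine Finset.sum_le_sum fun i _ => ?_
            by_cases hi : t < s i
            · simp [hx1 i hi]
            · have := (h.pos i).le
              gcongr
              exact not_lt.1 hi
        _ = t ^ 2 * ∑ i ∈ S, ‖inner ℂ (v i) x‖ ^ 2 := (Finset.mul_sum _ _ _).symm
        _ ≤ t ^ 2 * ‖x‖ ^ 2 := by
            gcongr; exact h.orthonormal_left.sum_inner_products_le x
    have := LinearMap.finrank_le_finrank_of_injective hφ
    rw [Module.finrank_fintype_fun_eq_card, Fintype.card_coe] at this
    simpa using this
  · have := encard_le_singCount (A := A) ht h.orthonormal_left (fun i j hij => by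
      change inner ℂ (A (v i)) (A (v j)) = 0
      rw [h.apply_eq, h.apply_eq, inner_smul_left, inner_smul_right, h.orthonormal_right.2 hij]
      simp)
    simpa [hnorm] using this

/-- Layer cake formula for sums of powers. -/
theorem tsum_ofReal_rpow {ι : Type*} {s : ι → ℝ} (hs : ∀ i, 0 ≤ s i) {p : ℝ} (hp : 0 < p) :
    ∑' i, ENNReal.ofReal (s i ^ p) = ENNReal.ofReal p *
      ∫⁻ t in Set.Ioi (0 : ℝ), ({i | t < s i}.encard : ℝ≥0∞) * ENNReal.ofReal (t ^ (p - 1)) := by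
  let _ : MeasurableSpace ι := ⊤
  have := lintegral_rpow_eq_lintegral_meas_lt_mul (μ := (Measure.count : Measure ι)) (f := s)
    (Eventually.of_forall hs) (measurable_from_top.aemeasurable) hp
  rw [lintegral_count] at this
  rw [this]
  simp_rw [Measure.count_apply MeasurableSpace.measurableSet_top]

/-- Through this formula inequalities for `singCount` pass to Schatten norms for every $p>0$,
without any triangle inequality or duality. -/
theorem schattenNorm_rpow_eq_lintegral {A : E →L[ℂ] F} (hA : IsCompactOperator A) {p : ℝ}
    (hp : 0 < p) : schattenNorm p A ^ p = ENNReal.ofReal p *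
      ∫⁻ t in Set.Ioi (0 : ℝ), singCount A t * ENNReal.ofReal (t ^ (p - 1)) := by
  obtain ⟨ι, v, w, s, h, hsum⟩ := exists_isSingularSystem hA
  rw [hsum p hp, tsum_ofReal_rpow (fun i => (h.pos i).le) hp]
  congr 1
  refine setLIntegral_congr_fun measurableSet_Ioi fun t ht => ?_
  rw [h.singCount_eq (le_of_lt ht)]

theorem schattenNorm_le_of_lintegral_le {A : E →L[ℂ] F} (hA : IsCompactOperator A) {p : ℝ}
    (hp : 0 < p) {c : ℝ≥0∞} (h : ENNReal.ofReal p *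
      ∫⁻ t in Set.Ioi (0 : ℝ), singCount A t * ENNReal.ofReal (t ^ (p - 1)) ≤ c ^ p) :
    schattenNorm p A ≤ c := by
  rw [← schattenNorm_rpow_eq_lintegral hA hp] at h
  exact (ENNReal.rpow_le_rpow_iff hp).1 h

theorem isCompactOperator_of_schattenNorm_lt_top {A : E →L[ℂ] F} {p : ℝ}
    (h : schattenNorm p A < ⊤) : IsCompactOperator A := by
  by_contra hA
  rw [schattenNorm, if_neg hA] at h
  exact lt_irrefl _ h

/-- Chebyshev's inequality for singular values. -/
theorem singCount_mul_le {A : E →L[ℂ] F} {p : ℝ} (hp : 0 < p) (hA : IsCompactOperator A) {t : ℝ}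
    (ht : 0 ≤ t) : singCount A t * ENNReal.ofReal (t ^ p) ≤ schattenNorm p A ^ p := by
  obtain ⟨ι, v, w, s, h, hsum⟩ := exists_isSingularSystem hA
  rw [hsum p hp, h.singCount_eq ht]
  let _ : MeasurableSpace ι := ⊤
  rw [← lintegral_count, ← Measure.count_apply MeasurableSpace.measurableSet_top, mul_comm]
  refine le_trans ?_ (mul_meas_ge_le_lintegral measurable_from_top (ENNReal.ofReal (t ^ p)))
  gcongr with i
  intro hi
  exact ENNReal.ofReal_le_ofReal (Real.rpow_le_rpow ht (le_of_lt hi) hp.le)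

theorem isCompactOperator_of_singCount_lt_top {A : E →L[ℂ] F}
    (h : ∀ t : ℝ, 0 < t → singCount A t < ⊤) : IsCompactOperator A := by
  refine isCompactOperator_of_orthonormal_bound fun t ht => ?_
  obtain ⟨n, hn⟩ := ENNReal.exists_nat_gt (h t ht).ne
  refine ⟨n, fun e he hAe => ?_⟩
  by_contra! hlt
  have := card_le_singCount ht.le he hAe hlt
  rw [Fintype.card_fin] at this
  exact absurd hn (not_lt.2 this)

theorem singCount_comp_le {E' : Type*} [NormedAddCommGroup E'] [InnerProductSpace ℂ E']
    [CompleteSpace E'] (A : E →L[ℂ] F) (J : E' →L[ℂ] E) (hJ : ∀ x, ‖J x‖ = ‖x‖) (t : ℝ) :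
    singCount (A ∘L J) t ≤ singCount A t := by
  refine singCount_le fun V hV hV' => ?_
  have hinj : Function.Injective (J : E' →ₗ[ℂ] E) := by
    rw [injective_iff_map_eq_zero]
    intro x hx
    rw [← norm_eq_zero, ← hJ x]
    simpa using hx
  rw [(Submodule.equivMapOfInjective (J : E' →ₗ[ℂ] E) hinj V).finrank_eq]
  refine finrank_le_singCount _ ?_
  rintro _ ⟨x, hx, rfl⟩ h0
  have hx0 : x ≠ 0 := by rintro rfl; simp at h0
  simpa [hJ] using hV' x hx hx0

theorem schattenNorm_comp_le {E' : Type*} [NormedAddCommGroup E'] [InnerProductSpace ℂ E']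
    [CompleteSpace E'] {p : ℝ} (hp : 0 < p) (A : E →L[ℂ] F) (J : E' →L[ℂ] E)
    (hJ : ∀ x, ‖J x‖ = ‖x‖) : schattenNorm p (A ∘L J) ≤ schattenNorm p A := by
  by_cases hA : IsCompactOperator A
  · refine schattenNorm_le_of_lintegral_le (hA.comp_clm J) hp ?_
    rw [schattenNorm_rpow_eq_lintegral hA hp]
    gcongr with t
    exact singCount_comp_le A J hJ t
  · rw [schattenNorm, schattenNorm, if_neg hA]; exact le_top

/-- Singular values are bounded below by the norms of images of an orthonormal family with
orthogonal images. -/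
theorem tsum_norm_rpow_le_schattenNorm {p : ℝ} (hp : 0 < p) (A : E →L[ℂ] F) {ι : Type*} {e : ι → E}
    (he : Orthonormal ℂ e) (hAe : Pairwise fun i j => inner ℂ (A (e i)) (A (e j)) = 0) :
    ∑' i, ENNReal.ofReal (‖A (e i)‖ ^ p) ≤ schattenNorm p A ^ p := by
  by_cases hA : IsCompactOperator A
  · rw [schattenNorm_rpow_eq_lintegral hA hp, tsum_ofReal_rpow (fun _ => norm_nonneg _) hp]
    refine mul_le_mul_right (setLIntegral_mono' measurableSet_Ioi fun t ht => ?_) _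
    gcongr
    exact encard_le_singCount (le_of_lt ht) he hAe
  · rw [schattenNorm, if_neg hA, ENNReal.top_rpow_of_pos hp]; exact le_top

theorem liminf_le_of_forall_le {u : ℕ → ℝ≥0∞} {c : ℝ≥0∞} (h : ∀ n, u n ≤ c) :
    liminf u atTop ≤ c :=
  (liminf_le_liminf (Eventually.of_forall h)).trans_eq (liminf_const c)

/-- Singular values are lower semicontinuous with respect to the weak operator topology. -/
theorem singCount_le_liminf {A : E →L[ℂ] F} {B : ℕ → E →L[ℂ] F}
    (hB : ∀ x y, Tendsto (fun n => inner ℂ y (B n x)) atTop (𝓝 (inner ℂ y (A x)))) (t : ℝ) :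
    singCount A t ≤ liminf (fun n => singCount (B n) t) atTop := by
  refine singCount_le fun V hV hV' => ?_
  suffices h : ∀ᶠ n in atTop, ∀ v ∈ V, v ≠ 0 → t * ‖v‖ < ‖B n v‖ from
    le_liminf_of_le (by isBoundedDefault) (h.mono fun n hn => finrank_le_singCount V hn)
  -- Compactness of the unit sphere of $V$ turns the strict inequality into a uniform gap, which
  -- leaves room for the approximation error.
  obtain ⟨r, hr0, hr⟩ : ∃ r : ℝ, 0 < r ∧ ∀ v : V, (t + r) * ‖v‖ ≤ ‖A v‖ := by
    obtain ⟨r, hr0, hr⟩ := (isCompact_sphere (0 : V) 1).exists_forall_le'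
      (f := fun v : V => ‖A v‖ - t * ‖v‖) (by fun_prop) (a := 0) (fun v hv => by
        have h1 : ‖v‖ = 1 := by simpa using hv
        have h0 : (v : E) ≠ 0 := by
          intro h0
          rw [Submodule.coe_norm, h0, norm_zero] at h1
          exact zero_ne_one h1
        exact sub_pos.2 (hV' v v.2 h0))
    refine ⟨r, hr0, fun v => ?_⟩
    by_cases hv : v = 0
    · simp [hv]
    have hvn : 0 < ‖v‖ := norm_pos_iff.2 hv
    have h1 := hr (((‖v‖ : ℝ) : ℂ)⁻¹ • v) (by
      rw [mem_sphere_zero_iff_norm, norm_smul, norm_inv, Complex.norm_real, norm_norm,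
        inv_mul_cancel₀ hvn.ne'])
    simp only [Submodule.coe_smul, map_smul, norm_smul, norm_inv, Complex.norm_real, norm_norm,
      inv_mul_cancel₀ hvn.ne'] at h1
    have h2 : r * ‖v‖ ≤ ‖A v‖ - t * ‖v‖ := by
      calc r * ‖v‖ ≤ (‖v‖⁻¹ * ‖A v‖ - t * 1) * ‖v‖ := by gcongr
        _ = _ := by field_simp
    linarith
  -- Projecting to the finite-dimensional $W=AV$ turns weak convergence into norm convergence, fixes
  -- $Av$, and does not increase $\|B_nv\|$.
  let W : Submodule ℂ F := V.map (A : E →ₗ[ℂ] F)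
  have hW : ∀ x : V, Tendsto (fun n => W.starProjection (B n x)) atTop (𝓝 (A x)) := fun x => by
    let o := stdOrthonormalBasis ℂ W
    have hP : ∀ y, W.starProjection y = ∑ j, inner ℂ (o j : F) y • (o j : F) := fun y => by
      rw [Submodule.starProjection_apply, o.orthogonalProjectionOnto_apply_eq_sum]
      simp
    have hx : W.starProjection (A x) = A x :=
      Submodule.starProjection_eq_self_iff.2 ⟨x, x.2, rfl⟩
    rw [← hx]
    simp_rw [hP]
    exact tendsto_finsetSum _ fun j _ => (hB x (o j)).smul_const _
  let e := stdOrthonormalBasis ℂ V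
  have hδ : Tendsto (fun n => ∑ i, ‖W.starProjection (B n (e i)) - A (e i)‖) atTop (𝓝 0) := by
    have : (0 : ℝ) = ∑ i : Fin (finrank ℂ V), 0 := by simp
    rw [this]
    exact tendsto_finsetSum _ fun i _ => tendsto_iff_norm_sub_tendsto_zero.1 (hW (e i))
  filter_upwards [hδ.eventually_lt_const hr0] with n hn v hv hv0
  have hvn : 0 < ‖v‖ := norm_pos_iff.2 hv0
  have hsum : v = ∑ i, e.repr ⟨v, hv⟩ i • (e i : E) := by
    have := congrArg V.subtype (e.sum_repr ⟨v, hv⟩)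
    rw [map_sum] at this
    simpa using this.symm
  have h1 : ‖W.starProjection (B n v) - A v‖ ≤
      ‖v‖ * ∑ i, ‖W.starProjection (B n (e i)) - A (e i)‖ := by
    have : W.starProjection (B n v) - A v =
        ∑ i, e.repr ⟨v, hv⟩ i • (W.starProjection (B n (e i)) - A (e i)) := by
      conv_lhs => rw [hsum]
      simp only [map_sum, map_smul, smul_sub, Finset.sum_sub_distrib]
    rw [this, Finset.mul_sum]
    refine (norm_sum_le _ _).trans (Finset.sum_le_sum fun i _ => ?_)
    rw [norm_smul]
    gcongr
    calc ‖e.repr ⟨v, hv⟩ i‖ ≤ ‖e.repr ⟨v, hv⟩‖ := PiLp.norm_apply_le _ i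
      _ = ‖v‖ := by rw [LinearIsometryEquiv.norm_map]; rfl
  have h2 : ‖W.starProjection (B n v)‖ ≤ ‖B n v‖ := Submodule.norm_starProjection_apply_le _ _
  have h3 : ‖A v‖ ≤ ‖W.starProjection (B n v)‖ + ‖W.starProjection (B n v) - A v‖ := by
    rw [norm_sub_rev]
    calc ‖A v‖ = ‖W.starProjection (B n v) + (A v - W.starProjection (B n v))‖ := by
          rw [add_sub_cancel]
      _ ≤ _ := norm_add_le _ _
  have h4 : (t + r) * ‖v‖ ≤ ‖A v‖ := hr ⟨v, hv⟩
  have h5 : ‖v‖ * ∑ i, ‖W.starProjection (B n (e i)) - A (e i)‖ < ‖v‖ * r := by gcongr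
  linarith

/-- Chebyshev bounds the counts of all $B_n$ uniformly at each level $t>0$, so the limit has finite
counts and is compact. The norm bound is then Fatou's lemma in $t$. -/
theorem schattenNorm_le_of_tendsto {A : E →L[ℂ] F} {B : ℕ → E →L[ℂ] F}
    (hB : ∀ x y, Tendsto (fun n => inner ℂ y (B n x)) atTop (𝓝 (inner ℂ y (A x)))) {p : ℝ}
    (hp : 0 < p) {c : ℝ≥0∞} (hBc : ∀ n, schattenNorm p (B n) ≤ c) : schattenNorm p A ≤ c := by
  by_cases hc : c = ⊤
  · rw [hc]; exact le_top
  have hBcomp : ∀ n, IsCompactOperator (B n) := fun n =>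
    isCompactOperator_of_schattenNorm_lt_top ((hBc n).trans_lt (lt_top_iff_ne_top.2 hc))
  have hA : IsCompactOperator A := by
    refine isCompactOperator_of_singCount_lt_top fun t ht => ?_
    have hb : ∀ n, singCount (B n) t ≤ c ^ p / ENNReal.ofReal (t ^ p) := fun n => by
      rw [ENNReal.le_div_iff_mul_le (Or.inl (by simpa using Real.rpow_pos_of_pos ht p))
        (Or.inl ENNReal.ofReal_ne_top)]
      exact (singCount_mul_le hp (hBcomp n) ht.le).trans (by gcongr; exact hBc n)
    refine lt_of_le_of_lt ((singCount_le_liminf hB t).trans (liminf_le_of_forall_le hb)) ?_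
    refine ENNReal.div_lt_top (ENNReal.rpow_ne_top_of_nonneg hp.le hc) ?_
    simpa using Real.rpow_pos_of_pos ht p
  refine schattenNorm_le_of_lintegral_le hA hp ?_
  have hmeas : ∀ n, Measurable fun t : ℝ => singCount (B n) t * ENNReal.ofReal (t ^ (p - 1)) :=
    fun n => (singCount_anti (B n)).measurable.mul (by fun_prop)
  calc _ ≤ ENNReal.ofReal p * ∫⁻ t in Set.Ioi (0 : ℝ),
        liminf (fun n => singCount (B n) t * ENNReal.ofReal (t ^ (p - 1))) atTop := by
        gcongr with t
        rw [ENNReal.liminf_mul_const_of_ne_top ENNReal.ofReal_ne_top]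
        exact (mul_le_mul_left (singCount_le_liminf hB t) _).trans_eq (mul_comm _ _)
    _ ≤ ENNReal.ofReal p * liminf (fun n => ∫⁻ t in Set.Ioi (0 : ℝ),
        singCount (B n) t * ENNReal.ofReal (t ^ (p - 1))) atTop := by
        gcongr
        exact lintegral_liminf_le hmeas
    _ = liminf (fun n => schattenNorm p (B n) ^ p) atTop := by
        simp_rw [schattenNorm_rpow_eq_lintegral (hBcomp _) hp]
        rw [ENNReal.liminf_const_mul_of_ne_top ENNReal.ofReal_ne_top]
    _ ≤ c ^ p := by
        exact liminf_le_of_forall_le fun n => by gcongr; exact hBc n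

end SingularCount

/-! ### Schatten norms through sums over orthonormal families. -/

section SchattenBounds

variable {E F : Type*} [NormedAddCommGroup E] [InnerProductSpace ℂ E] [CompleteSpace E]
  [NormedAddCommGroup F] [InnerProductSpace ℂ F] [CompleteSpace F]

/-- Jensen's inequality for a measure of arbitrary mass. -/
theorem lintegral_rpow_le {α : Type*} [MeasurableSpace α] {μ : Measure α}
    {f : α → ℝ≥0∞} (hf : AEMeasurable f μ) {q : ℝ} (hq : 1 ≤ q) :
    (∫⁻ x, f x ∂μ) ^ q ≤ μ Set.univ ^ (q - 1) * ∫⁻ x, f x ^ q ∂μ := by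
  have hq0 : 0 < q := one_pos.trans_le hq
  have h := eLpNorm'_le_eLpNorm'_mul_rpow_measure_univ (μ := μ) (f := f) one_pos hq
    hf.aestronglyMeasurable
  have h2 : (∫⁻ x, f x ∂μ) ≤ (∫⁻ x, f x ^ q ∂μ) ^ (1 / q) * μ Set.univ ^ (1 - 1 / q) := by
    simpa [eLpNorm'] using h
  refine (ENNReal.rpow_le_rpow h2 hq0.le).trans_eq ?_
  rw [ENNReal.mul_rpow_of_nonneg _ _ hq0.le, ← ENNReal.rpow_mul, ← ENNReal.rpow_mul,
    one_div_mul_cancel hq0.ne', ENNReal.rpow_one, mul_comm]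
  congr 2
  field_simp

theorem tsum_mul_rpow_le {ι : Type*} {a b : ι → ℝ≥0∞} (hb : ∑' i, b i ≤ 1) {q : ℝ} (hq : 1 ≤ q) :
    (∑' i, b i * a i) ^ q ≤ ∑' i, b i * a i ^ q := by
  let _ : MeasurableSpace ι := ⊤
  have hint : ∀ f : ι → ℝ≥0∞, ∫⁻ i, f i ∂(Measure.count.withDensity b) = ∑' i, b i * f i :=
    fun f => by
      rw [lintegral_withDensity_eq_lintegral_mul _ measurable_from_top measurable_from_top,
        lintegral_count]
      rfl
  have h := lintegral_rpow_le (μ := Measure.count.withDensity b) (f := a)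
    measurable_from_top.aemeasurable hq
  have huniv : Measure.count.withDensity b Set.univ ≤ 1 := by
    rw [withDensity_apply _ MeasurableSet.univ, Measure.restrict_univ, lintegral_count]
    exact hb
  rw [hint, hint] at h
  exact h.trans (mul_le_of_le_one_left' (ENNReal.rpow_le_one huniv (by linarith)))

theorem IsSingularSystem.ofReal_norm_sq_le {A : E →L[ℂ] F} {ι : Type*} {v : ι → E} {w : ι → F}
    {s : ι → ℝ} (h : IsSingularSystem A v w s) (x : E) :
    ENNReal.ofReal (‖A x‖ ^ 2) ≤
      ∑' i, ENNReal.ofReal (‖inner ℂ (v i) x‖ ^ 2) * ENNReal.ofReal (s i ^ 2) := by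
  by_cases hc : ∑' i, ENNReal.ofReal (‖inner ℂ (v i) x‖ ^ 2) * ENNReal.ofReal (s i ^ 2) = ⊤
  · rw [hc]; exact le_top
  rw [← ENNReal.ofReal_toReal hc]
  refine ENNReal.ofReal_le_ofReal (h.norm_sq_le x fun S => ?_)
  rw [← ENNReal.ofReal_le_iff_le_toReal hc, ENNReal.ofReal_sum_of_nonneg (fun i _ => by positivity)]
  refine le_trans (le_of_eq (Finset.sum_congr rfl fun i _ => ?_)) (ENNReal.sum_le_tsum S)
  rw [mul_comm, ENNReal.ofReal_mul (by positivity)]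

theorem ofReal_rpow_eq_sq_rpow {r : ℝ} (hr : 0 ≤ r) {p : ℝ} (hp : 0 ≤ p) :
    ENNReal.ofReal (r ^ p) = ENNReal.ofReal (r ^ 2) ^ (p / 2) := by
  rw [ENNReal.ofReal_rpow_of_nonneg (by positivity) (by positivity), ← Real.rpow_natCast,
    ← Real.rpow_mul hr]
  congr 2
  push_cast
  ring

/-- Since $p/2\ge1$, Jensen applies to $\|Ae_k\|^2\le\sum_i|\langle v_i,e_k\rangle|^2s_i^2$. By
Bessel the weights sum to at most $1$ over $i$, and likewise over $k$. -/
theorem IsSingularSystem.sum_norm_rpow_le {A : E →L[ℂ] F} {ι : Type*} {v : ι → E} {w : ι → F}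
    {s : ι → ℝ} (h : IsSingularSystem A v w s) {p : ℝ} (hp : 2 ≤ p) {κ : Type*} [Fintype κ]
    {e : κ → E} (he : Orthonormal ℂ e) :
    ∑ k, ENNReal.ofReal (‖A (e k)‖ ^ p) ≤ ∑' i, ENNReal.ofReal (s i ^ p) := by
  have hq : 1 ≤ p / 2 := by linarith
  have hs : ∀ i, ENNReal.ofReal (s i ^ 2) ^ (p / 2) = ENNReal.ofReal (s i ^ p) := fun i =>
    (ofReal_rpow_eq_sq_rpow (h.pos i).le (by linarith)).symm
  have hbes : ∀ x : E, ‖x‖ = 1 → ∑' i, ENNReal.ofReal (‖inner ℂ (v i) x‖ ^ 2) ≤ 1 := by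
    intro x hx
    rw [ENNReal.tsum_eq_iSup_sum]
    refine iSup_le fun S => ?_
    rw [← ENNReal.ofReal_sum_of_nonneg (fun _ _ => by positivity), ENNReal.ofReal_le_one]
    simpa [hx] using h.orthonormal_left.sum_inner_products_le x (s := S)
  calc ∑ k, ENNReal.ofReal (‖A (e k)‖ ^ p)
      ≤ ∑ k, ∑' i, ENNReal.ofReal (‖inner ℂ (v i) (e k)‖ ^ 2) * ENNReal.ofReal (s i ^ p) := by
        refine Finset.sum_le_sum fun k _ => ?_
        rw [ofReal_rpow_eq_sq_rpow (norm_nonneg _) (by linarith)]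
        refine (ENNReal.rpow_le_rpow (h.ofReal_norm_sq_le (e k)) (by linarith)).trans ?_
        simp_rw [← hs]
        exact tsum_mul_rpow_le (hbes _ (he.1 k)) hq
    _ = ∑' i, (∑ k, ENNReal.ofReal (‖inner ℂ (v i) (e k)‖ ^ 2)) * ENNReal.ofReal (s i ^ p) := by
        rw [← Summable.tsum_finsetSum fun _ _ => ENNReal.summable]
        simp_rw [Finset.sum_mul]
    _ ≤ ∑' i, ENNReal.ofReal (s i ^ p) := by
        refine ENNReal.tsum_le_tsum fun i => mul_le_of_le_one_left' ?_
        rw [← ENNReal.ofReal_sum_of_nonneg (fun _ _ => by positivity), ENNReal.ofReal_le_one]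
        have := he.sum_inner_products_le (v i) (s := Finset.univ)
        rw [h.orthonormal_left.1 i] at this
        simpa [norm_inner_symm] using this

theorem sum_norm_adjoint_rpow_le {A : E →L[ℂ] F} {p : ℝ} (hp : 2 ≤ p) {κ : Type*} [Fintype κ]
    {e : κ → F} (he : Orthonormal ℂ e) :
    ∑ k, ENNReal.ofReal (‖A.adjoint (e k)‖ ^ p) ≤ schattenNorm p A ^ p := by
  have hp0 : 0 < p := by linarith
  by_cases hA : IsCompactOperator A
  · obtain ⟨ι, v, w, s, h, hsum⟩ := exists_isSingularSystem hA
    rw [hsum p hp0]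
    exact h.adjoint.sum_norm_rpow_le hp he
  · rw [schattenNorm, if_neg hA, ENNReal.top_rpow_of_pos hp0]; exact le_top

theorem enorm_le_schattenNorm {p : ℝ} (hp : 2 ≤ p) (A : E →L[ℂ] F) : ‖A‖ₑ ≤ schattenNorm p A := by
  have hp0 : 0 < p := by linarith
  by_cases hc : schattenNorm p A = ⊤
  · rw [hc]; exact le_top
  rw [← ofReal_norm, ENNReal.ofReal_le_iff_le_toReal hc,
    ← ContinuousLinearMap.adjoint.norm_map A]
  refine ContinuousLinearMap.opNorm_le_bound _ ENNReal.toReal_nonneg fun y => ?_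
  by_cases hy : y = 0
  · simp [hy]
  have hyn : 0 < ‖y‖ := norm_pos_iff.2 hy
  have hnorm : ‖((‖y‖ : ℝ) : ℂ)⁻¹‖ = ‖y‖⁻¹ := by rw [norm_inv, Complex.norm_real, norm_norm]
  have h1 : Orthonormal ℂ fun _ : Unit => ((‖y‖ : ℝ) : ℂ)⁻¹ • y :=
    ⟨fun _ => by rw [norm_smul, hnorm, inv_mul_cancel₀ hyn.ne'], fun i j hij =>
      absurd (Subsingleton.elim i j) hij⟩
  have h2 := sum_norm_adjoint_rpow_le (A := A) hp h1
  rw [Fintype.sum_unique, ← ENNReal.ofReal_rpow_of_nonneg (norm_nonneg _) hp0.le,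
    ENNReal.rpow_le_rpow_iff hp0, ENNReal.ofReal_le_iff_le_toReal hc, map_smul, norm_smul, hnorm,
    ← div_eq_inv_mul, div_le_iff₀ hyn] at h2
  exact h2

/-- The right singular vectors $w_i$ already suffice, as $\|A^*w_i\|=s_i$. Compactness holds because
$n$ orthonormal vectors with $\|A^*e\|>t$ force $nt^p\le c^p$. -/
theorem schattenNorm_le_of_forall_orthonormal {A : E →L[ℂ] F} {p : ℝ} (hp : 0 < p) {c : ℝ≥0∞}
    (H : ∀ (κ : Type) [Fintype κ] (e : κ → F), Orthonormal ℂ e →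
      ∑ k, ENNReal.ofReal (‖A.adjoint (e k)‖ ^ p) ≤ c ^ p) : schattenNorm p A ≤ c := by
  by_cases hc : c = ⊤
  · rw [hc]; exact le_top
  have hA : IsCompactOperator A := by
    refine isCompactOperator_of_isCompactOperator_adjoint
      (isCompactOperator_of_orthonormal_bound fun t ht => ?_)
    have htp : ENNReal.ofReal (t ^ p) ≠ 0 := by simpa using Real.rpow_pos_of_pos ht p
    obtain ⟨n, hn⟩ := ENNReal.exists_nat_gt (ENNReal.div_lt_top
      (ENNReal.rpow_ne_top_of_nonneg hp.le hc) htp).ne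
    refine ⟨n, fun e he _ => ?_⟩
    by_contra! hlt
    rw [ENNReal.div_lt_iff (Or.inl htp) (Or.inl ENNReal.ofReal_ne_top)] at hn
    refine absurd hn (not_lt.2 (le_trans ?_ (H _ e he)))
    calc (n : ℝ≥0∞) * ENNReal.ofReal (t ^ p) = ∑ _k : Fin n, ENNReal.ofReal (t ^ p) := by simp
      _ ≤ _ := by
        gcongr with k
        exact (hlt k).le
  obtain ⟨ι, v, w, s, h, hsum⟩ := exists_isSingularSystem hA
  rw [← ENNReal.rpow_le_rpow_iff hp, hsum p hp]
  rw [ENNReal.tsum_eq_iSup_sum]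
  refine iSup_le fun S => ?_
  have := H S _ (h.orthonormal_right.comp (Subtype.val : S → ι) Subtype.val_injective)
  refine le_trans (le_of_eq ?_) this
  rw [← Finset.sum_coe_sort]
  refine Finset.sum_congr rfl fun i _ => ?_
  rw [Function.comp_apply, h.adjoint_apply_eq, norm_smul, h.orthonormal_left.1, mul_one,
    Complex.norm_real, Real.norm_of_nonneg (h.pos _).le]

end SchattenBounds

/-! ### Multiplication operators, tensors and normalized bumps. -/

section Multiplication

variable {h K : Type*} [NormedAddCommGroup h] [InnerProductSpace ℂ h]
  [NormedAddCommGroup K] [InnerProductSpace ℂ K]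

theorem aestronglyMeasurable_smul_coeFn {φ : ℝ → ℂ} (hφ : AEStronglyMeasurable φ) (u : L2 h) :
    AEStronglyMeasurable (fun x => φ x • u x) volume :=
  hφ.smul (Lp.aestronglyMeasurable u)

theorem coeFn_mulOp {φ : ℝ → ℂ} (f : (mulOp h φ).domain) :
    mulOp h φ f =ᵐ[volume] fun x => φ x • (f : L2 h) x :=
  MemLp.coeFn_toLp f.2

theorem coeFn_M (f : (M h).domain) : M h f =ᵐ[volume] fun x => (x : ℂ) • (f : L2 h) x :=
  MemLp.coeFn_toLp f.2

theorem mem_mulOp_domain_of_mem_LinftyComp (φ : L2 ℂ) {u : L2 h} (hu : u ∈ LinftyComp h) :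
    u ∈ (mulOp h φ).domain := by
  obtain ⟨R, hR⟩ := hu
  refine MemLp.of_le_mul (c := R) (Lp.memLp φ)
    (aestronglyMeasurable_smul_coeFn (Lp.aestronglyMeasurable φ) u) ?_
  filter_upwards [hR] with x hx
  rw [norm_smul, mul_comm]
  gcongr
  exact hx.1

theorem mem_M_domain_of_bounded_support {f : L2 h} {R : ℝ}
    (hf : ∀ᵐ x : ℝ, R < |x| → f x = 0) : f ∈ (M h).domain := by
  refine MemLp.of_le_mul (c := R) (Lp.memLp f)
    (aestronglyMeasurable_smul_coeFn (by fun_prop) f) ?_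
  filter_upwards [hf] with x hx
  by_cases hxR : R < |x|
  · simp [hx hxR]
  · rw [norm_smul, Complex.norm_real, Real.norm_eq_abs]
    gcongr
    exact not_lt.1 hxR

theorem mulOp_mem_M_domain (φ : L2 ℂ) {u : L2 h} (hu : u ∈ LinftyComp h)
    (hu' : u ∈ (mulOp h φ).domain) : mulOp h φ ⟨u, hu'⟩ ∈ (M h).domain := by
  obtain ⟨R, hR⟩ := hu
  refine mem_M_domain_of_bounded_support (R := R) ?_
  filter_upwards [hR, coeFn_mulOp (φ := φ) ⟨u, hu'⟩] with x hx hx' hxR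
  rw [hx', hx.2 hxR, smul_zero]

/-- The operator `a ↦ φ ⊗ a`. -/
def tensorL (h : Type*) [NormedAddCommGroup h] [InnerProductSpace ℂ h] (φ : L2 ℂ) :
    h →L[ℂ] L2 h :=
  LinearMap.mkContinuous
    { toFun := fun a => (ContinuousLinearMap.toSpanSingleton ℂ a).compLp φ
      map_add' := fun a b => by
        rw [← ContinuousLinearMap.add_compLp, ContinuousLinearMap.toSpanSingleton_add]
      map_smul' := fun c a => by
        rw [RingHom.id_apply, ← ContinuousLinearMap.smul_compLp]
        congr 1
        ext
        simp } ‖φ‖ fun a => by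
    refine (ContinuousLinearMap.norm_compLp_le _ φ).trans_eq ?_
    rw [ContinuousLinearMap.norm_toSpanSingleton, mul_comm]

theorem coeFn_tensorL (φ : L2 ℂ) (a : h) : tensorL h φ a =ᵐ[volume] fun x => φ x • a :=
  ContinuousLinearMap.coeFn_compLp _ _

theorem norm_tensorL (φ : L2 ℂ) (a : h) : ‖tensorL h φ a‖ = ‖φ‖ * ‖a‖ := by
  rw [Lp.norm_def, Lp.norm_def, eLpNorm_congr_ae (coeFn_tensorL φ a)]
  have : eLpNorm (fun x => φ x • a) 2 volume =
      eLpNorm (((‖a‖ : ℝ) : ℂ) • (φ : ℝ → ℂ)) 2 volume :=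
    eLpNorm_congr_norm_ae (Eventually.of_forall fun x => by
      simp [norm_smul, mul_comm])
  rw [this, eLpNorm_const_smul, ENNReal.toReal_mul]
  simp [mul_comm]

/-- The normalized indicator function of a closed interval. -/
def unitBump (x r : ℝ) : L2 ℂ :=
  indicatorConstLp 2 (Metric.isClosed_closedBall (x := x) (ε := r)).measurableSet
    measure_closedBall_lt_top.ne ((Real.sqrt (2 * r))⁻¹ : ℂ)

theorem norm_unitBump (x : ℝ) {r : ℝ} (hr : 0 < r) : ‖unitBump x r‖ = 1 := by
  rw [unitBump, norm_indicatorConstLp two_ne_zero ENNReal.ofNat_ne_top, measureReal_def,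
    Real.volume_closedBall, ENNReal.toReal_ofReal (by positivity), norm_inv, Complex.norm_real,
    Real.norm_of_nonneg (Real.sqrt_nonneg _), ENNReal.toReal_ofNat, ← Real.sqrt_eq_rpow]
  exact inv_mul_cancel₀ (Real.sqrt_pos.2 (by positivity)).ne'

theorem coeFn_unitBump (x r : ℝ) : unitBump x r =ᵐ[volume]
    (Metric.closedBall x r).indicator fun _ => ((Real.sqrt (2 * r))⁻¹ : ℂ) :=
  indicatorConstLp_coeFn

theorem tensorL_unitBump_mem (x r : ℝ) (a : h) : tensorL h (unitBump x r) a ∈ LinftyComp h := by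
  refine ⟨max (‖((Real.sqrt (2 * r))⁻¹ : ℂ)‖ * ‖a‖) (|x| + r), ?_⟩
  filter_upwards [coeFn_tensorL (unitBump x r) a, coeFn_unitBump x r] with y hy1 hy2
  rw [hy1, hy2]
  refine ⟨le_max_of_le_left ?_, fun hlt => ?_⟩
  · rw [norm_smul]
    gcongr
    exact norm_indicator_le_norm_self _ _
  · rw [Set.indicator_of_notMem, zero_smul]
    rw [Metric.mem_closedBall, Real.dist_eq]
    intro hle
    have h1 := (le_max_right _ _).trans_lt hlt
    have h2 : |y| ≤ |x| + |y - x| := by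
      calc |y| = |x + (y - x)| := by rw [add_sub_cancel]
        _ ≤ _ := abs_add_le _ _
    linarith

theorem coeFn_mulOp_unitBump {x r : ℝ} (hr : 0 < r) (a : h)
    (hu : tensorL h (unitBump x r) a ∈ (mulOp h (unitBump x r)).domain) :
    mulOp h (unitBump x r) ⟨tensorL h (unitBump x r) a, hu⟩ =ᵐ[volume]
      (Metric.closedBall x r).indicator fun _ => ((2 * r)⁻¹ : ℂ) • a := by
  filter_upwards [coeFn_mulOp ⟨_, hu⟩, coeFn_tensorL (unitBump x r) a, coeFn_unitBump x r]
    with y hy1 hy2 hy3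
  rw [hy1, hy2, hy3]
  by_cases hy : y ∈ Metric.closedBall x r
  · simp only [Set.indicator_of_mem hy, smul_smul]
    congr 1
    rw [← mul_inv, ← Complex.ofReal_mul, Real.mul_self_sqrt (by positivity)]
    push_cast; rfl
  · simp only [Set.indicator_of_notMem hy, zero_smul]

/-- `β` is a weak density of `G`: `⟨k, G f⟩ = ∫ ⟨β k x, f x⟩ dx`. -/
def IsWeakDensity (β : K → ℝ → h) (G : L2 h →ₗ.[ℂ] K) : Prop :=
  (∀ k, LocallyIntegrable (β k) volume) ∧ ∀ (k : K) (f : L2 h) (hG : f ∈ G.domain),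
    f ∈ (M h).domain → inner ℂ k (G ⟨f, hG⟩) = ∫ x, inner ℂ (β k x) (f x)

/-- The bump enters twice, as multiplier and as test vector, and its square is the indicator divided
by the length $2r$. -/
theorem IsWeakDensity.inner_apply [CompleteSpace h] {β : K → ℝ → h} {G : L2 h →ₗ.[ℂ] K}
    (hβ : IsWeakDensity β G) {x r : ℝ} (hr : 0 < r) {T : L2 h →L[ℂ] K}
    (hT : IsComp G (unitBump x r) T) (k : K) (a : h) :
    inner ℂ k (T (tensorL h (unitBump x r) a)) =
      inner ℂ (⨍ y in Metric.closedBall x r, β k y) a := by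
  have hmem := tensorL_unitBump_mem x r a
  obtain ⟨hu, hG, hTa⟩ := hT _ hmem
  rw [hTa, hβ.2 k _ hG (mulOp_mem_M_domain _ hmem hu)]
  have hint : IntegrableOn (β k) (Metric.closedBall x r) volume :=
    (hβ.1 k).integrableOn_isCompact (isCompact_closedBall x r)
  have h1 : ∫ y, inner ℂ (β k y) (mulOp h (unitBump x r) ⟨_, hu⟩ y) =
      ∫ y in Metric.closedBall x r, inner ℂ (β k y) (((2 * r)⁻¹ : ℂ) • a) := by
    rw [← integral_indicator Metric.isClosed_closedBall.measurableSet]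
    refine integral_congr_ae ?_
    filter_upwards [coeFn_mulOp_unitBump hr a hu] with y hy
    rw [hy]
    by_cases hy : y ∈ Metric.closedBall x r
    · simp only [Set.indicator_of_mem hy]
    · simp only [Set.indicator_of_notMem hy, inner_zero_right]
  have h2 : ∫ y in Metric.closedBall x r, inner ℂ (β k y) (((2 * r)⁻¹ : ℂ) • a) =
      inner ℂ (∫ y in Metric.closedBall x r, β k y) (((2 * r)⁻¹ : ℂ) • a) := by
    have := integral_inner (𝕜 := ℂ) hint (((2 * r)⁻¹ : ℂ) • a)
    rw [← inner_conj_symm, ← this, ← integral_conj]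
    simp_rw [inner_conj_symm]
  rw [h1, h2, setAverage_eq, measureReal_def, Real.volume_closedBall,
    ENNReal.toReal_ofReal (by positivity), inner_smul_right, ← Complex.coe_smul, inner_smul_left]
  simp [map_ofNat (starRingEnd ℂ) 2]

end Multiplication

/-! ### Weak densities and their differentiation. -/

section Density

variable {h K : Type*} [NormedAddCommGroup h] [InnerProductSpace ℂ h] [CompleteSpace h]
  [NormedAddCommGroup K] [InnerProductSpace ℂ K] [CompleteSpace K]

/-- Tensoring with a unit bump is isometric. Any other realization of $G\varphi(\mathcal M)$ agrees
with $T$ on these tensors, so the infimum in `compSchattenNorm` does no harm. -/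
theorem schattenNorm_comp_tensorL_le {p : ℝ} (hp : 0 < p) {G : L2 h →ₗ.[ℂ] K} {x r : ℝ}
    (hr : 0 < r) {T : L2 h →L[ℂ] K} (hT : IsComp G (unitBump x r) T) :
    schattenNorm p (T ∘L tensorL h (unitBump x r)) ≤ smoothPNorm p G := by
  refine le_trans ?_ (le_iSup₂_of_le (unitBump x r) (norm_unitBump x hr) le_rfl)
  refine le_iInf₂ fun T' hT' => ?_
  have heq : T ∘L tensorL h (unitBump x r) = T' ∘L tensorL h (unitBump x r) := by
    ext a
    obtain ⟨hu, hG, hTa⟩ := hT _ (tensorL_unitBump_mem x r a)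
    obtain ⟨hu', hG', hTa'⟩ := hT' _ (tensorL_unitBump_mem x r a)
    exact hTa.trans hTa'.symm
  rw [heq]
  exact schattenNorm_comp_le hp _ _ fun a => by rw [norm_tensorL, norm_unitBump x hr, one_mul]

/-- Bounded operators converging strongly on a dense sequence converge strongly. -/
theorem exists_tendsto_of_dense {E F : Type*} [NormedAddCommGroup E] [InnerProductSpace ℂ E]
    [NormedAddCommGroup F] [InnerProductSpace ℂ F] [CompleteSpace F] {B : ℕ → E →L[ℂ] F} {C : ℝ}
    (hC : ∀ n, ‖B n‖ ≤ C) {d : ℕ → E} (hd : DenseRange d) {b : ℕ → F}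
    (hb : ∀ j, Tendsto (fun n => B n (d j)) atTop (𝓝 (b j))) :
    ∃ L : E →L[ℂ] F, ‖L‖ ≤ C ∧ (∀ j, L (d j) = b j) ∧
      ∀ x, Tendsto (fun n => B n x) atTop (𝓝 (L x)) := by
  have hC0 : 0 ≤ C := (norm_nonneg _).trans (hC 0)
  have hcau : ∀ x, ∃ y, Tendsto (fun n => B n x) atTop (𝓝 y) := by
    intro x
    refine cauchySeq_tendsto_of_complete (Metric.cauchySeq_iff'.2 fun ε hε => ?_)
    obtain ⟨j, hj⟩ := hd.exists_dist_lt x (ε := ε / (4 * (C + 1))) (by positivity)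
    obtain ⟨N, hN⟩ := Metric.cauchySeq_iff'.1 (hb j).cauchySeq (ε / 2) (by positivity)
    refine ⟨N, fun n hn => ?_⟩
    have hclose : ∀ m, dist (B m x) (B m (d j)) ≤ ε / 4 := fun m => by
      rw [dist_eq_norm, ← map_sub]
      calc ‖B m (x - d j)‖ ≤ C * ‖x - d j‖ := (B m).le_of_opNorm_le (hC m) _
        _ ≤ (C + 1) * (ε / (4 * (C + 1))) := by
          rw [← dist_eq_norm]; gcongr; linarith
        _ = ε / 4 := by field_simp
    have h1 := hclose n
    have h2 := hclose N
    have h3 := hN n hn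
    have h4 := dist_triangle4_right (B n x) (B N x) (B n (d j)) (B N (d j))
    linarith
  choose f hf using hcau
  let L : E →L[ℂ] F := LinearMap.mkContinuous
    { toFun := f
      map_add' := fun x y => tendsto_nhds_unique (hf (x + y)) (by
        simpa using (hf x).add (hf y))
      map_smul' := fun c x => tendsto_nhds_unique (hf (c • x)) (by
        simpa using (hf x).const_smul c) } C fun x =>
    le_of_tendsto' (hf x).norm fun n => (B n).le_of_opNorm_le (hC n) x
  exact ⟨L, LinearMap.mkContinuous_norm_le _ hC0 _,
    fun j => tendsto_nhds_unique (hf (d j)) (hb j), hf⟩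

/-- Almost every value of a weak density of a smooth operator `G` comes from an operator whose
Schatten norm is bounded by the smoothness norm of `G`. -/
theorem IsWeakDensity.ae_exists {β : K → ℝ → h} {G : L2 h →ₗ.[ℂ] K} (hβ : IsWeakDensity β G)
    (hG : Smooth G) {d : ℕ → K} (hd : DenseRange d) :
    ∃ C : ℝ, ∀ p : ℝ, 0 < p → ∀ᵐ x : ℝ, ∃ B : h →L[ℂ] K, ‖B‖ ≤ C ∧
      (∀ j, B.adjoint (d j) = β (d j) x) ∧ schattenNorm p B ≤ smoothPNorm p G := by
  obtain ⟨C, hC⟩ := hG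
  refine ⟨C, fun p hp => ?_⟩
  -- Lebesgue differentiation has an exceptional null set for each vector, hence the restriction to
  -- countably many $d_j$.
  have hae : ∀ᵐ x : ℝ, ∀ j, Tendsto
      (fun n : ℕ => ⨍ y in Metric.closedBall x (1 / ((n : ℝ) + 1)), β (d j) y) atTop
      (𝓝 (β (d j) x)) := by
    rw [ae_all_iff]
    intro j
    filter_upwards [IsUnifLocDoublingMeasure.ae_tendsto_average (μ := (volume : Measure ℝ))
      (hβ.1 (d j)) 1] with x hx
    refine hx (fun _ => x) (fun n : ℕ => 1 / ((n : ℝ) + 1)) ?_ ?_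
    · exact tendsto_nhdsWithin_iff.2 ⟨tendsto_one_div_add_atTop_nhds_zero_nat,
        Eventually.of_forall fun n => Set.mem_Ioi.2 Nat.one_div_pos_of_nat⟩
    · exact Eventually.of_forall fun n =>
        Metric.mem_closedBall_self (by rw [one_mul]; exact (Nat.one_div_pos_of_nat).le)
  filter_upwards [hae] with x hx
  choose T hT hTC using hC
  let r : ℕ → ℝ := fun n => 1 / ((n : ℝ) + 1)
  have hr : ∀ n, 0 < r n := fun n => Nat.one_div_pos_of_nat
  let A : ℕ → h →L[ℂ] K := fun n => T (unitBump x (r n)) ∘L tensorL h (unitBump x (r n))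
  have hAC : ∀ n, ‖A n‖ ≤ C := fun n => by
    refine ContinuousLinearMap.opNorm_le_bound _ C.2 fun a => ?_
    have h1 := (T (unitBump x (r n))).le_of_opNorm_le (hTC _) (tensorL h (unitBump x (r n)) a)
    rwa [norm_tensorL, norm_unitBump x (hr n), mul_one, one_mul] at h1
  have hadj : ∀ n k, (A n).adjoint k = ⨍ y in Metric.closedBall x (r n), β k y := fun n k =>
    ext_inner_right ℂ fun a => by
      rw [ContinuousLinearMap.adjoint_inner_left]
      exact hβ.inner_apply (hr n) (hT _) k a
  -- It is the adjoints that converge strongly; the $A_n$ themselves converge only weakly, which is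
  -- enough for semicontinuity.
  obtain ⟨L, hLC, hLd, hL⟩ := exists_tendsto_of_dense (B := fun n => (A n).adjoint) (C := C)
    (fun n => (ContinuousLinearMap.adjoint.norm_map _).trans_le (hAC n)) hd
    (b := fun j => β (d j) x) (fun j => by simp_rw [hadj]; exact hx j)
  refine ⟨L.adjoint, (ContinuousLinearMap.adjoint.norm_map _).trans_le hLC, fun j => ?_, ?_⟩
  · rw [ContinuousLinearMap.adjoint_adjoint, hLd]
  · refine schattenNorm_le_of_tendsto (B := A) (fun a k => ?_) hp
      fun n => schattenNorm_comp_tensorL_le hp (hr n) (hT _)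
    rw [ContinuousLinearMap.adjoint_inner_right]
    simp_rw [← ContinuousLinearMap.adjoint_inner_left]
    exact (hL k).inner tendsto_const_nhds

theorem norm_sub_I_sq (x : ℝ) : ‖(x : ℂ) - Complex.I‖ ^ 2 = x ^ 2 + 1 := by
  rw [← Complex.normSq_eq_norm_sq, Complex.normSq_apply]; simp; ring

theorem sub_I_ne_zero (x : ℝ) : (x : ℂ) - Complex.I ≠ 0 := by
  intro h0
  have := norm_sub_I_sq x
  rw [h0] at this
  simp at this
  nlinarith [sq_nonneg x]

/-- A relatively bounded operator has a weak density. -/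
theorem exists_isWeakDensity {G : L2 h →ₗ.[ℂ] K} (hG : RelBounded (M h) G) :
    ∃ β : K → ℝ → h, IsWeakDensity β G := by
  obtain ⟨hdom, hb⟩ := hG
  obtain ⟨C, hC⟩ := hb Complex.I (by simp)
  let ρ : ℝ → ℂ := fun x => ((x : ℂ) - Complex.I)⁻¹
  have hρm : AEStronglyMeasurable ρ volume := by
    have : Measurable ρ := by fun_prop
    exact this.aestronglyMeasurable
  have hn : ∀ x : ℝ, 0 < ‖(x : ℂ) - Complex.I‖ := fun x => norm_pos_iff.2 (sub_I_ne_zero x)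
  have hρ1 : ∀ x, ‖ρ x‖ ≤ 1 := fun x => by
    rw [norm_inv]
    refine inv_le_one_of_one_le₀ ?_
    nlinarith [norm_sub_I_sq x, sq_nonneg x, hn x]
  have hρx : ∀ x : ℝ, ‖(x : ℂ) * ρ x‖ ≤ 1 := fun x => by
    rw [norm_mul, norm_inv, ← div_eq_mul_inv, div_le_one (hn x), Complex.norm_real]
    refine le_of_sq_le_sq ?_ (hn x).le
    rw [norm_sub_I_sq, Real.norm_eq_abs, sq_abs]
    linarith
  have hρL : ∀ u : L2 h, u ∈ (mulOp h ρ).domain := fun u => by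
    refine MemLp.mono (Lp.memLp u) (aestronglyMeasurable_smul_coeFn hρm u)
      (Eventually.of_forall fun x => ?_)
    rw [norm_smul]
    exact mul_le_of_le_one_left (norm_nonneg _) (hρ1 x)
  -- $R$ is the resolvent $(\mathcal M-i)^{-1}$, and $S$ below is $G(\mathcal M-i)^{-1}$.
  let R : L2 h →ₗ[ℂ] L2 h := (mulOp h ρ).toFun ∘ₗ
    LinearMap.codRestrict (mulOp h ρ).domain LinearMap.id hρL
  have hRcoe : ∀ u, R u =ᵐ[volume] fun x => ρ x • u x := fun u => coeFn_mulOp ⟨u, hρL u⟩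
  have hRM : ∀ u, R u ∈ (M h).domain := fun u => by
    refine MemLp.mono (Lp.memLp u) (aestronglyMeasurable_smul_coeFn (by fun_prop) _) ?_
    filter_upwards [hRcoe u] with x hx
    rw [hx, smul_smul, norm_smul]
    exact mul_le_of_le_one_left (norm_nonneg _) (hρx x)
  have hMR : ∀ u, M h ⟨R u, hRM u⟩ - Complex.I • R u = u := fun u => by
    refine Lp.ext ?_
    filter_upwards [Lp.coeFn_sub (M h ⟨R u, hRM u⟩) (Complex.I • R u),
      Lp.coeFn_smul Complex.I (R u), hRcoe u, coeFn_M ⟨R u, hRM u⟩]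
      with x h1 h2 h3 h4
    rw [h1, Pi.sub_apply, h2, Pi.smul_apply, h4, ← sub_smul, h3, smul_smul,
      mul_inv_cancel₀ (sub_I_ne_zero x), one_smul]
  let S : L2 h →L[ℂ] K := LinearMap.mkContinuous
    (G.toFun ∘ₗ LinearMap.codRestrict G.domain R fun u => hdom (hRM u)) C fun u => by
      have := hC (R u) (hRM u) (hdom (hRM u))
      rw [hMR u] at this
      exact this
  -- From $\langle k,Gf\rangle=\langle S^*k,(\mathcal M-i)f\rangle$ the factor $x-i$ moves to the
  -- first, conjugate-linear slot.
  refine ⟨fun k x => (starRingEnd ℂ) ((x : ℂ) - Complex.I) • (S.adjoint k) x, fun k => ?_,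
    fun k f hf hM => ?_⟩
  · have h1 : LocallyIntegrable (S.adjoint k : ℝ → h) volume :=
      (Lp.memLp (S.adjoint k)).locallyIntegrable one_le_two
    refine locallyIntegrable_iff.2 fun s hs => ?_
    refine IntegrableOn.continuousOn_smul (h1.integrableOn_isCompact hs) ?_ hs
    fun_prop
  · let u : L2 h := M h ⟨f, hM⟩ - Complex.I • f
    have hu : u =ᵐ[volume] fun x => ((x : ℂ) - Complex.I) • f x := by
      filter_upwards [Lp.coeFn_sub (M h ⟨f, hM⟩) (Complex.I • f),
        Lp.coeFn_smul Complex.I f, coeFn_M ⟨f, hM⟩]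
        with x h1 h2 h4
      rw [h1, Pi.sub_apply, h2, Pi.smul_apply, h4, ← sub_smul]
    have hRu : R u = f := by
      refine Lp.ext ?_
      filter_upwards [hRcoe u, hu] with x h1 h2
      rw [h1, h2, smul_smul, inv_mul_cancel₀ (sub_I_ne_zero x), one_smul]
    have hS : G ⟨f, hf⟩ = S u := by
      have : (⟨f, hf⟩ : G.domain) = ⟨R u, hdom (hRM u)⟩ := Subtype.ext hRu.symm
      rw [this]; rfl
    rw [hS, ← ContinuousLinearMap.adjoint_inner_left, L2.inner_def]
    refine integral_congr_ae ?_
    filter_upwards [hu] with x hx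
    rw [hx, inner_smul_right, inner_smul_left, Complex.conj_conj]

end Density

/-! ### Integrability of vectors in the domain of $\mathcal M$. -/

section Integrability

variable {h : Type*} [NormedAddCommGroup h] [InnerProductSpace ℂ h]

/-- The case $z=i$ is $\int(1+x^2)^{-1}dx<\infty$. Other $z$ compare with it through
$|x-i|\le|x-z|+|z-i|$ and $|\operatorname{Im}z|\le|x-z|$. -/
theorem memLp_inv_sub {z : ℂ} (hz : z.im ≠ 0) :
    MemLp (fun x : ℝ => ((x : ℂ) - z)⁻¹) 2 volume := by
  have hI : MemLp (fun x : ℝ => ((x : ℂ) - Complex.I)⁻¹) 2 volume := by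
    rw [memLp_two_iff_integrable_sq_norm
      (by exact (by fun_prop : Measurable _).aestronglyMeasurable)]
    refine integrable_inv_one_add_sq.congr (Eventually.of_forall fun x => ?_)
    simp only [norm_inv, inv_pow, norm_sub_I_sq]
    rw [add_comm]
  refine MemLp.of_le_mul (c := 1 + ‖z - Complex.I‖ / |z.im|) hI
    ((by fun_prop : Measurable _).aestronglyMeasurable) (Eventually.of_forall fun x => ?_)
  have him : 0 < |z.im| := abs_pos.2 hz
  have h1 : |z.im| ≤ ‖(x : ℂ) - z‖ := by
    have := Complex.abs_im_le_norm ((x : ℂ) - z)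
    simpa using this
  have h2 : 0 < ‖(x : ℂ) - z‖ := him.trans_le h1
  have h3 : 0 < ‖(x : ℂ) - Complex.I‖ := norm_pos_iff.2 (sub_I_ne_zero x)
  rw [norm_inv, norm_inv, ← div_eq_mul_inv, le_div_iff₀ h3, inv_mul_le_iff₀ h2]
  calc ‖(x : ℂ) - Complex.I‖ = ‖((x : ℂ) - z) + (z - Complex.I)‖ := by rw [sub_add_sub_cancel]
    _ ≤ ‖(x : ℂ) - z‖ + |z.im| * (‖z - Complex.I‖ / |z.im|) := by
      rw [mul_div_cancel₀ _ him.ne']; exact norm_add_le _ _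
    _ ≤ ‖(x : ℂ) - z‖ + ‖(x : ℂ) - z‖ * (‖z - Complex.I‖ / |z.im|) := by gcongr
    _ = _ := by ring

/-- Elements of the domain of `M` are integrable, with a bound in terms of `(M - z) f`. -/
theorem exists_integral_norm_le {z : ℂ} (hz : z.im ≠ 0) : ∃ C : ℝ, ∀ (f : L2 h)
    (hf : f ∈ (M h).domain), Integrable f volume ∧
      ∫ x, ‖f x‖ ≤ C * ‖M h ⟨f, hf⟩ - z • f‖ := by
  let ρ : ℝ → ℂ := fun x => ((x : ℂ) - z)⁻¹
  have hρ : MemLp ρ 2 volume := memLp_inv_sub hz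
  refine ⟨(eLpNorm ρ 2 volume).toReal, fun f hf => ?_⟩
  let u : L2 h := M h ⟨f, hf⟩ - z • f
  have hne : ∀ x : ℝ, (x : ℂ) - z ≠ 0 := fun x h0 => hz (by
    have := congrArg Complex.im h0
    simpa using this)
  have hfu : f =ᵐ[volume] ρ • (u : ℝ → h) := by
    filter_upwards [Lp.coeFn_sub (M h ⟨f, hf⟩) (z • f), Lp.coeFn_smul z f, coeFn_M ⟨f, hf⟩]
      with x h1 h2 h4
    rw [Pi.smul_apply', h1, Pi.sub_apply, h2, Pi.smul_apply, h4, ← sub_smul, smul_smul,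
      inv_mul_cancel₀ (hne x), one_smul]
  have hle : eLpNorm f 1 volume ≤ eLpNorm ρ 2 volume * eLpNorm u 2 volume := by
    rw [eLpNorm_congr_ae hfu]
    exact eLpNorm_smul_le_mul_eLpNorm (Lp.aestronglyMeasurable u) hρ.1
  have hfin : eLpNorm ρ 2 volume * eLpNorm u 2 volume < ⊤ :=
    ENNReal.mul_lt_top hρ.2 (Lp.memLp u).2
  have hint : Integrable f volume :=
    memLp_one_iff_integrable.1 ⟨Lp.aestronglyMeasurable f, hle.trans_lt hfin⟩
  refine ⟨hint, ?_⟩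
  rw [integral_norm_eq_lintegral_enorm hint.1, ← eLpNorm_one_eq_lintegral_enorm, Lp.norm_def,
    ← ENNReal.toReal_mul]
  exact ENNReal.toReal_mono hfin.ne hle

theorem integrable_of_mem_M_domain {f : L2 h} (hf : f ∈ (M h).domain) : Integrable f volume := by
  obtain ⟨C, hC⟩ := exists_integral_norm_le (h := h) (z := Complex.I) (by simp)
  exact (hC f hf).1

variable {K : Type*} [NormedAddCommGroup K] [InnerProductSpace ℂ K]

theorem integrable_apply {g : ℝ → h →L[ℂ] K} (hg : AEStronglyMeasurable g volume) {C : ℝ}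
    (hC : ∀ᵐ x : ℝ, ‖g x‖ ≤ C) {f : ℝ → h} (hf : Integrable f volume) :
    Integrable (fun x => g x (f x)) volume := by
  refine Integrable.mono' (hf.norm.const_mul C)
    ((ContinuousLinearMap.id ℂ (h →L[ℂ] K)).aestronglyMeasurable_comp₂ hg hf.1) ?_
  filter_upwards [hC] with x hx
  exact (g x).le_of_opNorm_le hx _

end Integrability

/-! ### Norm measurability of compact-operator-valued functions. -/

section Measurability

variable {h K : Type*} [NormedAddCommGroup h] [InnerProductSpace ℂ h] [CompleteSpace h]
  [NormedAddCommGroup K] [InnerProductSpace ℂ K] [CompleteSpace K]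

/-- Strong convergence of contractions is uniform on totally bounded sets, here the image of the
unit ball. -/
theorem tendsto_comp_of_isCompactOperator {A : h →L[ℂ] K} (hA : IsCompactOperator A)
    {P : ℕ → K →L[ℂ] K} (hP1 : ∀ n, ‖P n‖ ≤ 1) (hP : ∀ y, Tendsto (fun n => P n y) atTop (𝓝 y)) :
    Tendsto (fun n => P n ∘L A) atTop (𝓝 A) := by
  rw [Metric.tendsto_atTop']
  intro ε hε
  have htb : TotallyBounded (A '' Metric.closedBall 0 1) :=
    (IsCompactOperator.isCompact_closure_image_closedBall
      (f := (A : h →ₗ[ℂ] K)) hA 1).totallyBounded.subset subset_closure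
  obtain ⟨t, ht, hcov⟩ := Metric.totallyBounded_iff.1 htb (ε / 4) (by positivity)
  have hev : ∀ᶠ n in atTop, ∀ y ∈ t, dist (P n y) y < ε / 4 :=
    (Set.Finite.eventually_all ht).2 fun y _ => Metric.tendsto_nhds.1 (hP y) _ (by positivity)
  obtain ⟨N, hN⟩ := eventually_atTop.1 hev
  refine ⟨N, fun n hn => ?_⟩
  rw [dist_eq_norm]
  refine lt_of_le_of_lt ?_ (show 3 * (ε / 4) < ε by linarith)
  rw [← ContinuousLinearMap.sSup_unitClosedBall_eq_norm]
  refine csSup_le ((Metric.nonempty_closedBall.2 zero_le_one).image _) ?_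
  rintro _ ⟨x, hx, rfl⟩
  have hmem := hcov ⟨x, hx, rfl⟩
  simp only [Set.mem_iUnion, Metric.mem_ball, exists_prop] at hmem
  obtain ⟨y, hy, hd⟩ := hmem
  have h1 := hN n hn.le y hy
  have h2 : dist (P n (A x)) (P n y) ≤ dist (A x) y := by
    rw [dist_eq_norm, dist_eq_norm, ← map_sub]
    simpa using (P n).le_of_opNorm_le (hP1 n) (A x - y)
  have h3 := dist_triangle4 (P n (A x)) (P n y) y (A x)
  rw [dist_comm y] at h3
  change ‖P n (A x) - A x‖ ≤ _
  rw [← dist_eq_norm]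
  linarith

/-- Pettis' theorem for functions with values in the compact operators. -/
theorem aestronglyMeasurable_of_isCompactOperator [TopologicalSpace.SeparableSpace K]
    {α : Type*} [MeasurableSpace α] {μ : Measure α} {g : α → h →L[ℂ] K}
    (hc : ∀ᵐ x ∂μ, IsCompactOperator (g x))
    (hm : ∀ k, AEStronglyMeasurable (fun x => (g x).adjoint k) μ) : AEStronglyMeasurable g μ := by
  let U : ℕ → Submodule ℂ K := fun n =>
    Submodule.span ℂ (TopologicalSpace.denseSeq K '' Set.Iic n)
  have hfd : ∀ n, FiniteDimensional ℂ (U n) := fun n =>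
    FiniteDimensional.span_of_finite ℂ ((Set.finite_Iic n).image _)
  have hmono : Monotone U := fun m n hmn =>
    Submodule.span_mono (Set.image_mono (Set.Iic_subset_Iic.2 hmn))
  have hdense : ⊤ ≤ (⨆ n, U n).topologicalClosure := by
    intro y _
    refine closure_mono ?_ (TopologicalSpace.denseRange_denseSeq K y)
    rintro _ ⟨n, rfl⟩
    exact (le_iSup U n) (Submodule.subset_span ⟨n, Set.mem_Iic.2 le_rfl, rfl⟩)
  -- Each finite-rank compression is a finite sum of rank-one operators built from the measurable
  -- vectors $g(x)^*o_i$, and it converges to $g(x)$ in norm by compactness.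
  refine aestronglyMeasurable_of_tendsto_ae atTop (f := fun n x => (U n).starProjection ∘L g x)
    (fun n => ?_) ?_
  · let o := stdOrthonormalBasis ℂ (U n)
    have heq : (fun x => (U n).starProjection ∘L g x) =
        fun x => ∑ i, InnerProductSpace.rankOne ℂ (o i : K) ((g x).adjoint (o i)) := by
      funext x
      rw [o.starProjection_eq_sum_rankOne, ContinuousLinearMap.finsetSum_comp]
      exact Finset.sum_congr rfl fun i _ => InnerProductSpace.rankOne_comp _ _ _
    rw [heq]
    exact Finset.aestronglyMeasurable_fun_sum _ fun i _ =>
      (InnerProductSpace.rankOne ℂ (o i : K)).continuous.comp_aestronglyMeasurable (hm _)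
  · filter_upwards [hc] with x hx
    exact tendsto_comp_of_isCompactOperator hx
      (fun n => Submodule.starProjection_norm_le _)
      fun y => Submodule.starProjection_tendsto_self U hmono y hdense

end Measurability

/-! ### Representing a smooth operator. -/

section Existence

variable {h K : Type*} [NormedAddCommGroup h] [InnerProductSpace ℂ h] [CompleteSpace h]
  [NormedAddCommGroup K] [InnerProductSpace ℂ K] [CompleteSpace K]
  [TopologicalSpace.SeparableSpace K]

theorem eq_of_forall_inner_dense {d : ℕ → K} (hd : DenseRange d) {y z : K}
    (H : ∀ j, inner ℂ (d j) y = inner ℂ (d j) z) : y = z := by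
  refine ext_inner_left ℂ fun v => ?_
  have h1 : (fun v => inner ℂ v y) = fun v => inner ℂ v z :=
    hd.equalizer (by fun_prop) (by fun_prop) (funext H)
  exact congrFun h1 v

theorem exists_represents {G : L2 h →ₗ.[ℂ] K} (hrel : RelBounded (M h) G) (hG : Smooth G) {p : ℝ}
    (hp : 0 < p) (hfin : smoothPNorm p G < ⊤) : ∃ g : ℝ → h →L[ℂ] K,
      MemLinftySchatten p g ∧ Represents g G ∧ linftySchattenNorm p g ≤ smoothPNorm p G := by
  obtain ⟨β, hβ⟩ := exists_isWeakDensity hrel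
  have hd := TopologicalSpace.denseRange_denseSeq K
  obtain ⟨C, hC⟩ := hβ.ae_exists hG hd
  have hex := hC p hp
  obtain ⟨g, hg⟩ : ∃ g : ℝ → h →L[ℂ] K, ∀ᵐ x : ℝ, ‖g x‖ ≤ C ∧
      (∀ j, (g x).adjoint (TopologicalSpace.denseSeq K j) =
        β (TopologicalSpace.denseSeq K j) x) ∧ schattenNorm p (g x) ≤ smoothPNorm p G := by
    classical
    -- The pointwise choice is harmless for measurability: $g(x)^*$ is prescribed on a dense set by
    -- measurable functions.
    refine ⟨fun x => if hx : _ then Classical.choose (p := fun B : h →L[ℂ] K => ‖B‖ ≤ C ∧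
      (∀ j, B.adjoint (TopologicalSpace.denseSeq K j) =
        β (TopologicalSpace.denseSeq K j) x) ∧ schattenNorm p B ≤ smoothPNorm p G) hx else 0, ?_⟩
    filter_upwards [hex] with x hx
    rw [dif_pos hx]
    exact Classical.choose_spec hx
  have hmeas : ∀ k, AEStronglyMeasurable (fun x => (g x).adjoint k) volume := by
    intro k
    obtain ⟨s, hs, hlim⟩ := mem_closure_iff_seq_limit.1 (hd k)
    choose j hj using hs
    refine aestronglyMeasurable_of_tendsto_ae atTop (f := fun n x => (g x).adjoint (s n))
      (fun n => ?_) (Eventually.of_forall fun x => ((g x).adjoint.continuous.tendsto k).comp hlim)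
    refine (hβ.1 (s n)).aestronglyMeasurable.congr ?_
    filter_upwards [hg] with x hx
    rw [← hj n, hx.2.1]
  have hgm : AEStronglyMeasurable g volume := by
    refine aestronglyMeasurable_of_isCompactOperator ?_ hmeas
    filter_upwards [hg] with x hx
    exact isCompactOperator_of_schattenNorm_lt_top (hx.2.2.trans_lt hfin)
  have hle : linftySchattenNorm p g ≤ smoothPNorm p G := by
    refine essSup_le_of_ae_le _ ?_
    filter_upwards [hg] with x hx using hx.2.2
  refine ⟨g, ⟨hgm, hle.trans_lt hfin⟩, fun f hf => ⟨hrel.1 hf, ?_⟩, hle⟩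
  have hint : Integrable (fun x => g x (f x)) volume :=
    integrable_apply hgm (hg.mono fun x hx => hx.1) (integrable_of_mem_M_domain hf)
  refine ⟨hint, eq_of_forall_inner_dense hd fun j => ?_⟩
  rw [hβ.2 _ f _ hf, ← integral_inner hint]
  refine integral_congr_ae ?_
  filter_upwards [hg] with x hx
  rw [← hx.2.1, ContinuousLinearMap.adjoint_inner_left]

end Existence

/-! ### The converse and equality of norms for $p\ge2$. -/

section Converse

variable {h K : Type*} [NormedAddCommGroup h] [InnerProductSpace ℂ h] [CompleteSpace h]
  [NormedAddCommGroup K] [InnerProductSpace ℂ K] [CompleteSpace K]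

theorem aestronglyMeasurable_adjoint_apply {g : ℝ → h →L[ℂ] K} (hg : AEStronglyMeasurable g volume)
    (k : K) : AEStronglyMeasurable (fun x => (g x).adjoint k) volume :=
  (ContinuousLinearMap.adjoint.continuous.comp_aestronglyMeasurable hg).apply_continuousLinearMap k

theorem MemLinftySchatten.ae_enorm_le {p : ℝ} (hp : 2 ≤ p) (g : ℝ → h →L[ℂ] K) :
    ∀ᵐ x : ℝ, ‖g x‖ₑ ≤ linftySchattenNorm p g := by
  filter_upwards [ae_le_essSup (μ := (volume : Measure ℝ))
    (f := fun x => schattenNorm p (g x))] with x hx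
  exact (enorm_le_schattenNorm hp _).trans hx

theorem MemLinftySchatten.ae_norm_le {p : ℝ} (hp : 2 ≤ p) {g : ℝ → h →L[ℂ] K}
    (hg : MemLinftySchatten p g) : ∀ᵐ x : ℝ, ‖g x‖ ≤ (linftySchattenNorm p g).toReal := by
  filter_upwards [MemLinftySchatten.ae_enorm_le hp g] with x hx
  rwa [← ENNReal.ofReal_le_iff_le_toReal hg.2.ne, ofReal_norm]

theorem Represents.isWeakDensity {g : ℝ → h →L[ℂ] K} {G : L2 h →ₗ.[ℂ] K} (hgG : Represents g G)
    (hg : AEStronglyMeasurable g volume) {C : ℝ} (hC : ∀ᵐ x : ℝ, ‖g x‖ ≤ C) :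
    IsWeakDensity (fun k x => (g x).adjoint k) G := by
  refine ⟨fun k => ?_, fun k f hf hM => ?_⟩
  · refine MemLp.locallyIntegrable (p := ⊤) (memLp_top_of_bound
      (aestronglyMeasurable_adjoint_apply hg k) (C * ‖k‖) ?_) le_top
    filter_upwards [hC] with x hx
    exact (g x).adjoint.le_of_opNorm_le
      ((ContinuousLinearMap.adjoint.norm_map (g x)).trans_le hx) k
  · obtain ⟨hG, hint, heq⟩ := hgG f hM
    rw [heq, ← integral_inner hint]
    simp_rw [ContinuousLinearMap.adjoint_inner_left]

/-- The operator `k ↦ conj φ • g* k`, the adjoint of `G φ(M)`. -/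
theorem exists_adjoint_comp {g : ℝ → h →L[ℂ] K} (hg : AEStronglyMeasurable g volume) {C : ℝ}
    (hC0 : 0 ≤ C) (hC : ∀ᵐ x : ℝ, ‖g x‖ ≤ C) (φ : L2 ℂ) : ∃ S : K →L[ℂ] L2 h, ‖S‖ ≤ C * ‖φ‖ ∧
      ∀ k, S k =ᵐ[volume] fun x => (starRingEnd ℂ) (φ x) • (g x).adjoint k := by
  have hm : ∀ k, AEStronglyMeasurable
      (fun x => (starRingEnd ℂ) (φ x) • (g x).adjoint k) volume := fun k =>
    (Complex.continuous_conj.comp_aestronglyMeasurable (Lp.aestronglyMeasurable φ)).smul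
      (aestronglyMeasurable_adjoint_apply hg k)
  have hb : ∀ k, ∀ᵐ x : ℝ, ‖(starRingEnd ℂ) (φ x) • (g x).adjoint k‖ ≤ (C * ‖k‖) * ‖φ x‖ := by
    intro k
    filter_upwards [hC] with x hx
    rw [norm_smul, RCLike.norm_conj, mul_comm]
    gcongr
    exact (g x).adjoint.le_of_opNorm_le
      ((ContinuousLinearMap.adjoint.norm_map (g x)).trans_le hx) k
  have hL : ∀ k, MemLp (fun x => (starRingEnd ℂ) (φ x) • (g x).adjoint k) 2 volume := fun k =>
    MemLp.of_le_mul (Lp.memLp φ) (hm k) (hb k)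
  let S : K →L[ℂ] L2 h := LinearMap.mkContinuous
    { toFun := fun k => (hL k).toLp
      map_add' := fun k k' => by
        rw [← MemLp.toLp_add]
        refine MemLp.toLp_congr _ _ (Eventually.of_forall fun x => ?_)
        simp only [map_add, smul_add, Pi.add_apply]
      map_smul' := fun c k => by
        rw [RingHom.id_apply, ← MemLp.toLp_const_smul]
        refine MemLp.toLp_congr _ _ (Eventually.of_forall fun x => ?_)
        simp only [map_smul, Pi.smul_apply, smul_comm c] } (C * ‖φ‖) fun k => by
    have := Lp.norm_le_mul_norm_of_ae_le_mul (f := (hL k).toLp) (g := φ) (c := C * ‖k‖) (by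
      filter_upwards [hb k, (hL k).coeFn_toLp] with x h1 h2
      rwa [h2])
    refine this.trans_eq (by ring)
  exact ⟨S, LinearMap.mkContinuous_norm_le _ (by positivity) _, fun k => (hL k).coeFn_toLp⟩

theorem Represents.isComp_adjoint {g : ℝ → h →L[ℂ] K} {G : L2 h →ₗ.[ℂ] K} (hgG : Represents g G)
    {φ : L2 ℂ} {S : K →L[ℂ] L2 h}
    (hS : ∀ k, S k =ᵐ[volume] fun x => (starRingEnd ℂ) (φ x) • (g x).adjoint k) :
    IsComp G φ S.adjoint := by
  intro u hu
  have hdom := mem_mulOp_domain_of_mem_LinftyComp φ hu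
  obtain ⟨hG, hint, heq⟩ := hgG _ (mulOp_mem_M_domain φ hu hdom)
  refine ⟨hdom, hG, ?_⟩
  rw [heq]
  refine ext_inner_left ℂ fun k => ?_
  rw [ContinuousLinearMap.adjoint_inner_right, L2.inner_def, ← integral_inner hint]
  refine integral_congr_ae ?_
  filter_upwards [hS k, coeFn_mulOp (φ := φ) ⟨u, hdom⟩] with x h1 h2
  rw [h1, h2, inner_smul_left, Complex.conj_conj, map_smul, inner_smul_right,
    ContinuousLinearMap.adjoint_inner_left]

theorem enorm_sq_eq_lintegral {E : Type*} [NormedAddCommGroup E] (f : L2 E) :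
    ‖f‖ₑ ^ 2 = ∫⁻ x, ‖f x‖ₑ ^ 2 := by
  rw [Lp.enorm_def, eLpNorm_eq_lintegral_rpow_enorm_toReal two_ne_zero ENNReal.ofNat_ne_top,
    ← ENNReal.rpow_natCast, ← ENNReal.rpow_mul]
  simp

/-- With $d\mu=|\varphi|^2dx$ one has $\|Se_k\|^2=\int\|g(x)^*e_k\|^2d\mu$. Jensen with exponent
$p/2\ge1$ allows summing over $k$ under the integral; the total mass $\|\varphi\|^2$ contributes the
powers $p/2-1$ and $1$, together $\|\varphi\|^p$. -/
theorem schattenNorm_adjoint_le {g : ℝ → h →L[ℂ] K} (hg : AEStronglyMeasurable g volume) {p : ℝ}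
    (hp : 2 ≤ p) {φ : L2 ℂ} {S : K →L[ℂ] L2 h}
    (hS : ∀ k, S k =ᵐ[volume] fun x => (starRingEnd ℂ) (φ x) • (g x).adjoint k) :
    schattenNorm p S.adjoint ≤ linftySchattenNorm p g * ‖φ‖ₑ := by
  have hp0 : 0 < p := by linarith
  have hq : 1 ≤ p / 2 := by linarith
  have hpow : ∀ a : ℝ≥0∞, (a ^ 2) ^ (p / 2) = a ^ p := fun a => by
    rw [← ENNReal.rpow_natCast, ← ENNReal.rpow_mul]
    congr 1
    push_cast; ring
  have hof : ∀ {E : Type _} [NormedAddCommGroup E] (y : E),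
      ENNReal.ofReal (‖y‖ ^ p) = ‖y‖ₑ ^ p := fun y => by
    rw [← ENNReal.ofReal_rpow_of_nonneg (norm_nonneg _) hp0.le, ofReal_norm]
  refine schattenNorm_le_of_forall_orthonormal hp0 fun κ _ e he => ?_
  rw [ContinuousLinearMap.adjoint_adjoint]
  let w : ℝ → ℝ≥0∞ := fun x => ‖φ x‖ₑ ^ 2
  have hw : AEMeasurable w volume := (Lp.aestronglyMeasurable φ).enorm.pow_const 2
  let μ : Measure ℝ := volume.withDensity w
  have hμ : μ Set.univ = ‖φ‖ₑ ^ 2 := by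
    rw [withDensity_apply _ MeasurableSet.univ, Measure.restrict_univ, enorm_sq_eq_lintegral]
  have hac : μ ≪ volume := withDensity_absolutelyContinuous _ _
  have hgm : ∀ k, AEMeasurable (fun x => ‖(g x).adjoint (e k)‖ₑ) volume := fun k =>
    (aestronglyMeasurable_adjoint_apply hg _).enorm
  have hterm : ∀ k, ENNReal.ofReal (‖S (e k)‖ ^ p) ≤
      (‖φ‖ₑ ^ 2) ^ (p / 2 - 1) * ∫⁻ x, ‖(g x).adjoint (e k)‖ₑ ^ p ∂μ := fun k => by
    have h1 : ‖S (e k)‖ₑ ^ 2 = ∫⁻ x, ‖(g x).adjoint (e k)‖ₑ ^ 2 ∂μ := by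
      rw [enorm_sq_eq_lintegral, lintegral_withDensity_eq_lintegral_mul₀ hw ((hgm k).pow_const 2)]
      refine lintegral_congr_ae ?_
      filter_upwards [hS (e k)] with x hx
      rw [hx, enorm_smul, mul_pow, Pi.mul_apply, RCLike.enorm_conj]
    rw [hof, ← hpow, h1, ← hμ]
    refine (lintegral_rpow_le (((hgm k).pow_const 2).mono_ac hac) hq).trans_eq ?_
    simp_rw [hpow]
  calc ∑ k, ENNReal.ofReal (‖S (e k)‖ ^ p)
      ≤ ∑ k, (‖φ‖ₑ ^ 2) ^ (p / 2 - 1) * ∫⁻ x, ‖(g x).adjoint (e k)‖ₑ ^ p ∂μ :=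
        Finset.sum_le_sum fun k _ => hterm k
    _ = (‖φ‖ₑ ^ 2) ^ (p / 2 - 1) * ∫⁻ x, ∑ k, ‖(g x).adjoint (e k)‖ₑ ^ p ∂μ := by
        rw [← Finset.mul_sum, lintegral_finsetSum' _ fun k _ =>
          ((hgm k).pow_const p).mono_ac hac]
    _ ≤ (‖φ‖ₑ ^ 2) ^ (p / 2 - 1) * ∫⁻ _x, linftySchattenNorm p g ^ p ∂μ := by
        gcongr 1
        refine lintegral_mono_ae (hac.ae_le ?_)
        filter_upwards [ae_le_essSup (μ := (volume : Measure ℝ))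
          (f := fun x => schattenNorm p (g x))] with x hx
        have := sum_norm_adjoint_rpow_le (A := g x) hp he
        simp_rw [hof] at this
        exact this.trans (ENNReal.rpow_le_rpow hx hp0.le)
    _ = (linftySchattenNorm p g * ‖φ‖ₑ) ^ p := by
        rw [lintegral_const, hμ, mul_comm (linftySchattenNorm p g ^ p), ← mul_assoc,
          ENNReal.mul_rpow_of_nonneg _ _ hp0.le, mul_comm (linftySchattenNorm p g ^ p), ← hpow ‖φ‖ₑ]
        congr 1
        nth_rewrite 2 [← ENNReal.rpow_one (‖φ‖ₑ ^ 2)]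
        rw [← ENNReal.rpow_add_of_nonneg _ _ (by linarith) zero_le_one, sub_add_cancel]

theorem Represents.smooth_and_compSchattenNorm_le {g : ℝ → h →L[ℂ] K} {G : L2 h →ₗ.[ℂ] K}
    (hgG : Represents g G) {p : ℝ} (hp : 2 ≤ p) (hg : MemLinftySchatten p g) :
    Smooth G ∧ ∀ φ : L2 ℂ, compSchattenNorm p G φ ≤ linftySchattenNorm p g * ‖φ‖ₑ := by
  have hC := hg.ae_norm_le hp
  have hS := fun φ : L2 ℂ => exists_adjoint_comp hg.1 ENNReal.toReal_nonneg hC φ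
  refine ⟨⟨(linftySchattenNorm p g).toNNReal, fun φ => ?_⟩, fun φ => ?_⟩
  · obtain ⟨S, hSn, hS⟩ := hS φ
    exact ⟨S.adjoint, hgG.isComp_adjoint hS, (ContinuousLinearMap.adjoint.norm_map S).trans_le hSn⟩
  · obtain ⟨S, -, hS⟩ := hS φ
    exact (iInf₂_le _ (hgG.isComp_adjoint hS)).trans (schattenNorm_adjoint_le hg.1 hp hS)

theorem smoothPNorm_le {G : L2 h →ₗ.[ℂ] K} {p : ℝ} {c : ℝ≥0∞}
    (H : ∀ φ : L2 ℂ, compSchattenNorm p G φ ≤ c * ‖φ‖ₑ) : smoothPNorm p G ≤ c :=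
  iSup₂_le fun φ hφ => (H φ).trans_eq (by rw [← ofReal_norm, hφ]; simp)

theorem Represents.smoothP {g : ℝ → h →L[ℂ] K} {G : L2 h →ₗ.[ℂ] K}
    (hgG : Represents g G) {p : ℝ} (hp : 2 ≤ p) (hg : MemLinftySchatten p g) : SmoothP p G := by
  obtain ⟨h1, h2⟩ := hgG.smooth_and_compSchattenNorm_le hp hg
  refine ⟨h1, (linftySchattenNorm p g).toNNReal, fun φ => ?_⟩
  rw [ENNReal.coe_toNNReal hg.2.ne]
  exact h2 φ

/-- For the lower bound on the smoothness norm, $k\mapsto g(\cdot)^*k$ is itself a weak density, so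
the operator obtained by differentiation equals $g(x)$ almost everywhere. -/
theorem Represents.linftySchattenNorm_eq [TopologicalSpace.SeparableSpace K]
    {g : ℝ → h →L[ℂ] K} {G : L2 h →ₗ.[ℂ] K} (hgG : Represents g G) {p : ℝ} (hp : 2 ≤ p)
    (hg : MemLinftySchatten p g) : linftySchattenNorm p g = smoothPNorm p G := by
  obtain ⟨h1, h2⟩ := hgG.smooth_and_compSchattenNorm_le hp hg
  refine le_antisymm ?_ (smoothPNorm_le h2)
  have hd := TopologicalSpace.denseRange_denseSeq K
  obtain ⟨C, hC⟩ := (hgG.isWeakDensity hg.1 (hg.ae_norm_le hp)).ae_exists h1 hd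
  refine essSup_le_of_ae_le _ ?_
  filter_upwards [hC p (by linarith)] with x hx
  obtain ⟨B, -, hB, hBp⟩ := hx
  have heq : B.adjoint = (g x).adjoint := by
    ext k
    have := hd.equalizer B.adjoint.continuous (g x).adjoint.continuous (funext hB)
    exact congrFun this k
  rw [← ContinuousLinearMap.adjoint.injective heq]
  exact hBp

end Converse

/-! ### Operators defined by bounded operator functions. -/

section Construction

variable {h K : Type*} [NormedAddCommGroup h] [InnerProductSpace ℂ h]
  [NormedAddCommGroup K] [InnerProductSpace ℂ K] [CompleteSpace K]

/-- Every bounded measurable operator function represents an `M`-bounded operator. -/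
theorem exists_relBounded_represents {g : ℝ → h →L[ℂ] K} (hg : AEStronglyMeasurable g volume)
    {C : ℝ} (hC0 : 0 ≤ C) (hC : ∀ᵐ x : ℝ, ‖g x‖ ≤ C) :
    ∃ G : L2 h →ₗ.[ℂ] K, RelBounded (M h) G ∧ Represents g G := by
  have hint : ∀ f : (M h).domain, Integrable (fun x => g x ((f : L2 h) x)) volume := fun f =>
    integrable_apply hg hC (integrable_of_mem_M_domain f.2)
  let G : L2 h →ₗ.[ℂ] K :=
    { domain := (M h).domain
      toFun :=
        { toFun := fun f => ∫ x, g x ((f : L2 h) x)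
          map_add' := fun a b => by
            rw [← integral_add (hint a) (hint b)]
            refine integral_congr_ae ?_
            filter_upwards [Lp.coeFn_add (a : L2 h) (b : L2 h)] with x hx
            rw [Submodule.coe_add, hx, Pi.add_apply, map_add]
          map_smul' := fun c a => by
            rw [RingHom.id_apply, ← integral_smul]
            refine integral_congr_ae ?_
            filter_upwards [Lp.coeFn_smul c (a : L2 h)] with x hx
            rw [Submodule.coe_smul, hx, Pi.smul_apply, map_smul] } }
  refine ⟨G, ⟨le_rfl, fun z hz => ?_⟩, fun f hf => ⟨hf, hint ⟨f, hf⟩, rfl⟩⟩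
  obtain ⟨D, hD⟩ := exists_integral_norm_le (h := h) hz
  refine ⟨C * D, fun u hu hG => ?_⟩
  obtain ⟨hui, hub⟩ := hD u hu
  calc ‖∫ x, g x (u x)‖ ≤ ∫ x, C * ‖u x‖ := by
        refine norm_integral_le_of_norm_le (hui.norm.const_mul C) ?_
        filter_upwards [hC] with x hx using (g x).le_of_opNorm_le hx _
    _ = C * ∫ x, ‖u x‖ := integral_const_mul _ _
    _ ≤ C * (D * ‖M h ⟨u, hu⟩ - z • u‖) := by gcongr
    _ = _ := by ring

end Construction

/-! ### The counterexample for $p<2$. -/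

section Counterexample

variable {H : Type*} [NormedAddCommGroup H] [InnerProductSpace ℂ H] [CompleteSpace H]

/-- Any singular system will do, because `singCount` does not depend on the system. This permits
computing norms from an explicit one. -/
theorem IsSingularSystem.schattenNorm_rpow {E F : Type*} [NormedAddCommGroup E]
    [InnerProductSpace ℂ E] [CompleteSpace E] [NormedAddCommGroup F] [InnerProductSpace ℂ F]
    [CompleteSpace F] {A : E →L[ℂ] F} {ι : Type*} {v : ι → E} {w : ι → F} {s : ι → ℝ}
    (h : IsSingularSystem A v w s) (hA : IsCompactOperator A) {p : ℝ} (hp : 0 < p) :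
    schattenNorm p A ^ p = ∑' i, ENNReal.ofReal (s i ^ p) := by
  rw [schattenNorm_rpow_eq_lintegral hA hp, tsum_ofReal_rpow (fun i => (h.pos i).le) hp]
  congr 1
  refine setLIntegral_congr_fun measurableSet_Ioi fun t ht => ?_
  rw [h.singCount_eq (le_of_lt ht)]

theorem schattenNorm_rankOne_self {y : H} (hy : ‖y‖ = 1) {p : ℝ} (hp : 0 < p) :
    schattenNorm p (InnerProductSpace.rankOne ℂ y y) = 1 := by
  have hc : IsCompactOperator (InnerProductSpace.rankOne ℂ y y) := by
    rw [InnerProductSpace.rankOne_def']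
    exact (isCompactOperator_of_locallyCompactSpace_rng
      (ContinuousLinearMap.toSpanSingleton ℂ y)).comp_clm (innerSL ℂ y)
  have horth : Orthonormal ℂ fun _ : Unit => y :=
    ⟨fun _ => hy, fun i j hij => absurd (Subsingleton.elim i j) hij⟩
  have hsys : IsSingularSystem (InnerProductSpace.rankOne ℂ y y) (fun _ : Unit => y)
      (fun _ => y) fun _ => 1 :=
    { pos := fun _ => one_pos
      orthonormal_left := horth
      orthonormal_right := horth
      apply_eq := fun _ => by simp [hy]
      adjoint_apply_eq := fun _ => by simp [hy]
      eq_zero := fun x hx => by simp [hx ()] }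
  have := hsys.schattenNorm_rpow hc hp
  rw [tsum_fintype] at this
  simp only [Real.one_rpow, ENNReal.ofReal_one, Finset.univ_unique, Finset.sum_const,
    Finset.card_singleton, one_smul] at this
  rw [← ENNReal.one_rpow p] at this
  exact ENNReal.rpow_left_injective hp.ne' this

/-- The function equal to the projection onto the span of `e n` for `n ≤ |x| < n + 1`. -/
def stepProjection (e : ℕ → H) (x : ℝ) : H →L[ℂ] H :=
  InnerProductSpace.rankOne ℂ (e ⌊|x|⌋₊) (e ⌊|x|⌋₊)

theorem aestronglyMeasurable_comp_floor_abs {E : Type*} [TopologicalSpace E] (a : ℕ → E) :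
    AEStronglyMeasurable (fun x : ℝ => a ⌊|x|⌋₊) volume :=
  ((StronglyMeasurable.of_discrete (f := a)).comp_measurable
    (Nat.measurable_floor.comp measurable_norm)).aestronglyMeasurable

theorem memLp_floor_abs_rpow {p : ℝ} (hp : 0 < p) (hp2 : p < 2) :
    MemLp (fun x : ℝ => (((((⌊|x|⌋₊ : ℕ) : ℝ) + 1) ^ (-(1 / p)) : ℝ) : ℂ)) 2 volume := by
  have hm : AEStronglyMeasurable
      (fun x : ℝ => (((((⌊|x|⌋₊ : ℕ) : ℝ) + 1) ^ (-(1 / p)) : ℝ) : ℂ)) volume :=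
    aestronglyMeasurable_comp_floor_abs fun n : ℕ => ((((n : ℝ) + 1) ^ (-(1 / p)) : ℝ) : ℂ)
  rw [memLp_two_iff_integrable_sq_norm hm]
  have hint : Integrable (fun x : ℝ => (1 + ‖x‖) ^ (-(2 / p))) volume :=
    integrable_one_add_norm (by
      rw [Module.finrank_self, Nat.cast_one, one_lt_div hp]; exact hp2)
  -- The constant comes from $\lfloor|x|\rfloor+1\ge(1+|x|)/2$ raised to the negative power $-2/p$.
  refine Integrable.mono' (hint.const_mul ((1 / 2) ^ (-(2 / p)))) (hm.norm.pow 2)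
    (Eventually.of_forall fun x => ?_)
  have hfl : |x| < (⌊|x|⌋₊ : ℝ) + 1 := Nat.lt_floor_add_one _
  have hn0 : (0 : ℝ) ≤ (⌊|x|⌋₊ : ℝ) := Nat.cast_nonneg _
  rw [Complex.norm_real, Real.norm_of_nonneg (by positivity), Real.norm_of_nonneg (by positivity),
    ← Real.rpow_natCast, ← Real.rpow_mul (by positivity), ← Real.mul_rpow (by norm_num)
    (by positivity)]
  have hexp : -(1 / p) * ((2 : ℕ) : ℝ) = -(2 / p) := by push_cast; ring
  rw [hexp]
  refine Real.rpow_le_rpow_of_nonpos (by positivity) ?_ (by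
    rw [neg_nonpos]; positivity)
  rw [Real.norm_eq_abs]
  linarith

/-- The functions `1_{[n, n + 1)} ⊗ e n`. -/
def stepVector (e : ℕ → H) (n : ℕ) : L2 H :=
  indicatorConstLp 2 (measurableSet_Ico (a := (n : ℝ)) (b := n + 1)) measure_Ico_lt_top.ne (e n)

theorem coeFn_stepVector (e : ℕ → H) (n : ℕ) :
    stepVector e n =ᵐ[volume] (Set.Ico (n : ℝ) (n + 1)).indicator fun _ => e n :=
  indicatorConstLp_coeFn

theorem orthonormal_stepVector {e : ℕ → H} (he : Orthonormal ℂ e) :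
    Orthonormal ℂ (stepVector e) := by
  refine ⟨fun n => ?_, fun m n hmn => ?_⟩
  · rw [stepVector, norm_indicatorConstLp two_ne_zero ENNReal.ofNat_ne_top, he.1]
    simp [measureReal_def]
  · change inner ℂ (stepVector e m) (stepVector e n) = 0
    rw [L2.inner_def, ← integral_zero ℝ ℂ]
    refine integral_congr_ae ?_
    filter_upwards [coeFn_stepVector e m, coeFn_stepVector e n] with x h1 h2
    rw [h1, h2]
    by_cases h3 : x ∈ Set.Ico (m : ℝ) (m + 1)
    · by_cases h4 : x ∈ Set.Ico (n : ℝ) (n + 1)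
      · rw [Set.indicator_of_mem h3, Set.indicator_of_mem h4, he.2 hmn]
      · rw [Set.indicator_of_notMem h4, inner_zero_right]
    · rw [Set.indicator_of_notMem h3, inner_zero_left]

theorem floor_abs_of_mem_Ico {n : ℕ} {x : ℝ} (hx : x ∈ Set.Ico (n : ℝ) (n + 1)) :
    ⌊|x|⌋₊ = n := by
  have h0 : 0 ≤ x := (Nat.cast_nonneg n).trans hx.1
  rw [abs_of_nonneg h0]
  exact (Nat.floor_eq_iff h0).2 hx

theorem stepVector_mem {e : ℕ → H} (he : Orthonormal ℂ e) (n : ℕ) :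
    stepVector e n ∈ LinftyComp H := by
  refine ⟨(n : ℝ) + 1, ?_⟩
  filter_upwards [coeFn_stepVector e n] with x hx
  rw [hx]
  refine ⟨(norm_indicator_le_norm_self _ _).trans ?_, fun hlt => Set.indicator_of_notMem ?_ _⟩
  · rw [he.1]
    have := Nat.cast_nonneg (α := ℝ) n
    linarith
  · intro hmem
    have h0 : 0 ≤ x := (Nat.cast_nonneg n).trans hmem.1
    rw [abs_of_nonneg h0] at hlt
    exact lt_asymm hlt hmem.2

theorem Represents.isComp_stepVector {e : ℕ → H} (he : Orthonormal ℂ e) {G : L2 H →ₗ.[ℂ] H}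
    (hG : Represents (stepProjection e) G) {φ : L2 ℂ} {a : ℕ → ℂ}
    (hφ : φ =ᵐ[volume] fun x => a ⌊|x|⌋₊) {T : L2 H →L[ℂ] H} (hT : IsComp G φ T) (n : ℕ) :
    T (stepVector e n) = a n • e n := by
  have hmem := stepVector_mem he n
  obtain ⟨hu, hGu, hTu⟩ := hT _ hmem
  obtain ⟨_, -, heq⟩ := hG _ (mulOp_mem_M_domain φ hmem hu)
  rw [hTu, heq]
  have h1 : ∫ x, stepProjection e x (mulOp H φ ⟨stepVector e n, hu⟩ x) =
      ∫ x, (Set.Ico (n : ℝ) (n + 1)).indicator (fun _ => a n • e n) x := by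
    refine integral_congr_ae ?_
    filter_upwards [coeFn_mulOp (φ := φ) ⟨_, hu⟩, hφ, coeFn_stepVector e n] with x h1 h2 h3
    rw [h1, h2, h3]
    by_cases hx : x ∈ Set.Ico (n : ℝ) (n + 1)
    · rw [Set.indicator_of_mem hx, Set.indicator_of_mem hx, stepProjection,
        floor_abs_of_mem_Ico hx, map_smul, InnerProductSpace.rankOne_apply,
        inner_self_eq_norm_sq_to_K, he.1]
      simp
    · rw [Set.indicator_of_notMem hx, Set.indicator_of_notMem hx, smul_zero, map_zero]
  rw [h1, integral_indicator_const _ measurableSet_Ico]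
  simp [measureReal_def]

/-- The exponent $-1/p$ is borderline: the images of the orthonormal step vectors are
$(n+1)^{-1/p}e_n$, whose $p$-th powers sum to the harmonic series, while $\varphi\in L^2$ because
$2/p>1$. -/
theorem Represents.not_smoothP {e : ℕ → H} (he : Orthonormal ℂ e) {G : L2 H →ₗ.[ℂ] H}
    (hG : Represents (stepProjection e) G) {p : ℝ} (hp : 0 < p) (hp2 : p < 2) :
    ¬ SmoothP p G := by
  rintro ⟨-, C, hC⟩
  let φ : L2 ℂ := (memLp_floor_abs_rpow hp hp2).toLp
  have hlt : compSchattenNorm p G φ < ⊤ :=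
    (hC φ).trans_lt (ENNReal.mul_lt_top ENNReal.coe_lt_top enorm_lt_top)
  obtain ⟨T, hT⟩ := iInf_lt_iff.1 hlt
  obtain ⟨hT, hTp⟩ := iInf_lt_iff.1 hT
  have hTn := hG.isComp_stepVector he
    (a := fun n : ℕ => ((((n : ℝ) + 1) ^ (-(1 / p)) : ℝ) : ℂ)) (MemLp.coeFn_toLp _) hT
  have hsum := tsum_norm_rpow_le_schattenNorm hp T (orthonormal_stepVector he)
    (fun m n hmn => by
      change inner ℂ (T (stepVector e m)) (T (stepVector e n)) = 0
      rw [hTn, hTn, inner_smul_left, inner_smul_right, he.2 hmn, mul_zero, mul_zero])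
  have hterm : ∀ n, ‖T (stepVector e n)‖ ^ p = 1 / ((n : ℝ) + 1) := fun n => by
    rw [hTn, norm_smul, he.1, mul_one, Complex.norm_real, Real.norm_of_nonneg (by positivity),
      ← Real.rpow_mul (by positivity), neg_mul, one_div_mul_cancel hp.ne', Real.rpow_neg_one,
      one_div]
  simp_rw [hterm] at hsum
  have hs := ENNReal.summable_toReal
    (hsum.trans_lt (ENNReal.rpow_lt_top_of_nonneg hp.le hTp.ne)).ne
  refine Real.not_summable_one_div_natCast ((summable_nat_add_iff 1).1 (hs.congr fun n => ?_))
  rw [ENNReal.toReal_ofReal (by positivity)]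
  push_cast
  rfl

theorem exists_represents_not_smoothP {e : ℕ → H} (he : Orthonormal ℂ e) :
    ∃ (G : L2 H →ₗ.[ℂ] H) (g : ℝ → H →L[ℂ] H), RelBounded (M H) G ∧ Represents g G ∧
      (∀ p : ℝ, 0 < p → MemLinftySchatten p g ∧ linftySchattenNorm p g = 1) ∧
      ∀ p : ℝ, 0 < p → p < 2 → ¬ SmoothP p G := by
  have hm : AEStronglyMeasurable (stepProjection e) volume :=
    aestronglyMeasurable_comp_floor_abs fun n => InnerProductSpace.rankOne ℂ (e n) (e n)
  have hsch : ∀ p : ℝ, 0 < p → linftySchattenNorm p (stepProjection e) = 1 := fun p hp => by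
    have : (fun x => schattenNorm p (stepProjection e x)) = fun _ => 1 :=
      funext fun x => schattenNorm_rankOne_self (he.1 _) hp
    rw [linftySchattenNorm, this, essSup_const']
  have hmem : ∀ p : ℝ, 0 < p → MemLinftySchatten p (stepProjection e) := fun p hp =>
    ⟨hm, by rw [hsch p hp]; exact ENNReal.one_lt_top⟩
  obtain ⟨G, hrel, hG⟩ := exists_relBounded_represents hm ENNReal.toReal_nonneg
    ((hmem 2 two_pos).ae_norm_le le_rfl)
  exact ⟨G, stepProjection e, hrel, hG, fun p hp => ⟨hmem p hp, hsch p hp⟩,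
    fun p hp hp2 => hG.not_smoothP he hp hp2⟩

end Counterexample

theorem SmoothP.smoothPNorm_lt_top {h K : Type*} [NormedAddCommGroup h] [InnerProductSpace ℂ h]
    [CompleteSpace h] [NormedAddCommGroup K] [InnerProductSpace ℂ K] [CompleteSpace K]
    {G : L2 h →ₗ.[ℂ] K} {p : ℝ} (hG : SmoothP p G) : smoothPNorm p G < ⊤ := by
  obtain ⟨-, C, hC⟩ := hG
  exact (smoothPNorm_le hC).trans_lt ENNReal.coe_lt_top

end KatoSmooth

end

theorem theorem3p3 :
    (∀ (h K : Type*)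
        [NormedAddCommGroup h] [InnerProductSpace ℂ h] [CompleteSpace h]
        [TopologicalSpace.SeparableSpace h]
        [NormedAddCommGroup K] [InnerProductSpace ℂ K] [CompleteSpace K]
        [TopologicalSpace.SeparableSpace K]
        (G : KatoSmooth.L2 h →ₗ.[ℂ] K), KatoSmooth.RelBounded (KatoSmooth.M h) G →
      (∀ p : ℝ, 2 ≤ p →
        (KatoSmooth.SmoothP p G ↔
          ∃ g : ℝ → h →L[ℂ] K,
            KatoSmooth.MemLinftySchatten p g ∧ KatoSmooth.Represents g G) ∧
        (∀ g : ℝ → h →L[ℂ] K,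
          KatoSmooth.MemLinftySchatten p g → KatoSmooth.Represents g G →
            KatoSmooth.linftySchattenNorm p g = KatoSmooth.smoothPNorm p G)) ∧
      (∀ p : ℝ, 0 < p → p < 2 → KatoSmooth.SmoothP p G →
        ∃ g : ℝ → h →L[ℂ] K,
          KatoSmooth.MemLinftySchatten p g ∧ KatoSmooth.Represents g G ∧
            KatoSmooth.linftySchattenNorm p g ≤ KatoSmooth.smoothPNorm p G)) ∧
    (∃ (G : KatoSmooth.L2 (lp (fun _ : ℕ => ℂ) 2) →ₗ.[ℂ] lp (fun _ : ℕ => ℂ) 2)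
        (g : ℝ → lp (fun _ : ℕ => ℂ) 2 →L[ℂ] lp (fun _ : ℕ => ℂ) 2),
      KatoSmooth.RelBounded (KatoSmooth.M (lp (fun _ : ℕ => ℂ) 2)) G ∧
      KatoSmooth.Represents g G ∧
      (∀ p : ℝ, 0 < p →
        KatoSmooth.MemLinftySchatten p g ∧ KatoSmooth.linftySchattenNorm p g = 1) ∧
      (∀ p : ℝ, 0 < p → p < 2 → ¬ KatoSmooth.SmoothP p G)) := by
  refine ⟨?_, ?_⟩
  · intro h K _ _ _ _ _ _ _ _ G hrel
    refine ⟨fun p hp => ⟨⟨fun hG => ?_, fun ⟨g, hg, hgG⟩ => hgG.smoothP hp hg⟩,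
      fun g hg hgG => hgG.linftySchattenNorm_eq hp hg⟩, fun p hp _ hG =>
      KatoSmooth.exists_represents hrel hG.1 hp hG.smoothPNorm_lt_top⟩
    obtain ⟨g, hg, hgG, -⟩ :=
      KatoSmooth.exists_represents hrel hG.1 (two_pos.trans_le hp) hG.smoothPNorm_lt_top
    exact ⟨g, hg, hgG⟩
  · exact KatoSmooth.exists_represents_not_smoothP
      -- The identity of $\ell^2$, read as a coordinate map, supplies the standard basis.
      (HilbertBasis.ofRepr (LinearIsometryEquiv.refl ℂ (lp (fun _ : ℕ => ℂ) 2))).orthonormal
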